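/- **Definitions.** A $\mathbb{Z}^2$-subshift over a finite alphabet $\mathcal{A}$ is a closed subset $X\subseteq\mathcal{A}^{\mathbb{Z}^2}$ (product topology, $\mathcal{A}$ discrete) that is invariant under all shifts $(\sigma_v x)_p=x_{p-v}$, $v\in\mathbb{Z}^2$; it is minimal if it is nonempty and every point of $X$ has a dense shift orbit in $X$. The extended symmetry group $\mathrm{Sym}(X,\mathbb{Z}^2)$ is the group, under composition, of all homeomorphisms $f:X\to X$ for which there is $A\in\mathrm{GL}_2(\mathbb{Z})$ with $f\circ\sigma_v=\sigma_{Av}\circ f$ for all $v\in\mathbb{Z}^2$. The Robinson tiles are the $28$ rotations and reflections of the following five unit squares $[0,1]^2$ decorated with black and red arrows. 1. A black main arrow from $(\tfrac12,1)$ to $(\tfrac12,0)$, and two black side arrows entering at $(0,\tfrac12)$ and at $(1,\tfrac12)$ and ending at the main arrow. 2. Tile 1, with in addition a red arrow from $(\tfrac14,1)$ to $(\tfrac14,0)$ and two red side arrows entering horizontally at $(0,\tfrac14)$ and at $(1,\tfrac14)$ and ending inside the tile. 3. (The *cross*.) Four black arrows with their heads at the midpoints of the four sides, and a red L-shaped arrow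 through $(\tfrac14,1),(\tfrac14,\tfrac14),(1,\tfrac14)$ with heads at its two ends $(\tfrac14,1)$ and $(1,\tfrac14)$. 4. Tile 1, with in addition the two red side arrows of tile 2. 5. Tile 1, with in addition the red arrow from $(\tfrac14,1)$ to $(\tfrac14,0)$. The Robinson shift $X_{\mathrm{Rob}}$ is the set of all configurations $x$ of these tiles on $\mathbb{Z}^2$ such that (1) on the common side of any two adjacent tiles, each arrow head of either tile meets, at the same point, an arrow tail of the same colour of the other tile, and each arrow tail meets an arrow head in the same way; and, for some $k\in\mathbb{Z}^2$, (2) all tiles at positions in $k+2\mathbb{Z}^2$ are crosses, and (3) every other cross lies at a position in $k+(1,1)+2\mathbb{Z}^2$. **Statement.** There is exactly one minimal subshift $M_{\mathrm{Rob}}\subseteq X_{\mathrm{Rob}}$, and $$\mathrm{Sym}(M_{\mathrm{Rob}},\mathbb{Z}^2)\cong\mathbb{Z}^2\rtimes D_4,$$ where $D_4$ is the dihedral group of order $8$, acting on $\mathbb{Z}^2$ in the standard way as the group of matrices generated by $\begin{bmatrix}0&-1\\1&0\end{bmatrix}$ and $\begin{bmatrix}-1&0\\0&1\end{bmatrix}$.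 -/

import Mathlib

namespace Robinson

open Matrix

/-! ### Subshifts of `A^(ℤ^d)` and their extended symmetries -/

/-- The lattice `ℤ^d`. -/
abbrev Lattice (d : ℕ) : Type := Fin d → ℤ

/-- The full shift `A^(ℤ^d)`; for a discrete alphabet it carries the product topology. -/
abbrev Config (A : Type) (d : ℕ) : Type := Lattice d → A

/-- The shift action `(σ_v x)_p = x_(p - v)`. -/
def shift {A : Type} {d : ℕ} (v : Lattice d) (x : Config A d) : Config A d :=
  fun p => x (p - v)

/-- A subshift: a closed, shift-invariant set of configurations. -/
structure Subshift (A : Type) [TopologicalSpace A] (d : ℕ) where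
  carrier : Set (Config A d)
  isClosed : IsClosed carrier
  shift_mem : ∀ (v : Lattice d) (x : Config A d), x ∈ carrier → shift v x ∈ carrier

namespace Subshift

variable {A : Type} [TopologicalSpace A] {d : ℕ}

/-- A subshift is minimal if it is nonempty and each of its points has a dense orbit in it. -/
def IsMinimal (X : Subshift A d) : Prop :=
  X.carrier.Nonempty ∧
    ∀ x ∈ X.carrier, X.carrier ⊆ closure (Set.range fun v : Lattice d => shift v x)

/-- The shift `σ_v` as a self-map of a subshift. -/
def shiftMap (X : Subshift A d) (v : Lattice d) (x : X.carrier) : X.carrier :=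
  ⟨shift v x.1, X.shift_mem v x.1 x.2⟩

/-- `f ∘ σ_v = σ_(M v) ∘ f` for all `v ∈ ℤ^d`. -/
def IsMorphism (X : Subshift A d) (M : GL (Fin d) ℤ) (f : X.carrier → X.carrier) : Prop :=
  ∀ (v : Lattice d) (x : X.carrier), f (X.shiftMap v x) = X.shiftMap (M.1 *ᵥ v) (f x)

/-- The group of extended symmetries: the self-homeomorphisms of `X` that satisfy
`f ∘ σ_v = σ_(M v) ∘ f` for some `M ∈ GL_d(ℤ)`, under composition. (For a finite discrete
alphabet `X` is compact Hausdorff, so continuous bijections of `X` are homeomorphisms.) -/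
def Sym (X : Subshift A d) : Subgroup (X.carrier ≃ₜ X.carrier) where
  carrier := {f | ∃ M : GL (Fin d) ℤ, X.IsMorphism M f}
  one_mem' := ⟨1, fun v x => by simp⟩
  mul_mem' := by
    rintro f g ⟨M, hM⟩ ⟨N, hN⟩
    refine ⟨M * N, fun v x => ?_⟩
    have h : f (g (X.shiftMap v x)) = X.shiftMap ((M * N).1 *ᵥ v) (f (g x)) := by
      rw [hN v x, hM, Matrix.mulVec_mulVec]
      rfl
    exact h
  inv_mem' := by
    rintro f ⟨M, hM⟩
    refine ⟨M⁻¹, fun v x => ?_⟩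
    have h : f.symm (X.shiftMap v x) = X.shiftMap ((M⁻¹).1 *ᵥ v) (f.symm x) := by
      apply f.injective
      rw [hM, Matrix.mulVec_mulVec, ← Units.val_mul, mul_inv_cancel]
      simp
    exact h

end Subshift

/-! ### The Robinson tiles -/

/-- The four directions, which also name the four sides of a unit square: `vert` tells
vertical from horizontal, `pos` tells north/east from south/west. -/
structure Dir where
  vert : Bool
  pos : Bool
deriving DecidableEq, Fintype

namespace Dir

def opp (d : Dir) : Dir := ⟨d.vert, !d.pos⟩

/-- One of the two directions perpendicular to `d`. -/
def perp (d : Dir) (s : Bool) : Dir := ⟨!d.vert, s⟩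

/-- The unit vector of a direction; coordinate `0` is horizontal, coordinate `1` vertical. -/
def vec (d : Dir) : Lattice 2 :=
  Pi.single (if d.vert then 1 else 0) (if d.pos then 1 else -1)

end Dir

/-- What is drawn on one side of a tile. Every side of every tile is met at its midpoint by
exactly one black arrow, by its head (`head = true`) or by its tail (`head = false`).
In addition there may be a red arrow, always parallel to the black one and with the same
sense; `red = some t` means that it meets the side at the point a quarter of the side length
away from the midpoint in the direction `t`. -/
structure Mark where
  head : Bool
  red : Option Dir
deriving DecidableEq

/-- The `28` rotations and reflections of the five Robinson tiles.

`cross a b`: four black arrow heads, one on each side, and a red L-shaped two-headed arrow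
that points to the horizontal direction `⟨false, a⟩` and to the vertical direction
`⟨true, b⟩`, its corner lying in the opposite quarter of the tile.

`arm m r s`: a black main arrow that crosses the tile in the direction `m`, and two black side
arrows that enter through the two other sides and end at the main arrow. If `r = some t`, a red
arrow runs parallel to the main arrow, displaced in the direction `m.perp t`. If `s` holds, each
of the two side arrows has a parallel red arrow, displaced in the direction `m`. The values
`(none, false)`, `(some _, true)`, `(none, true)`, `(some _, false)` of `(r, s)` give the
first, second, fourth and fifth tile type; the cross is the third. -/
inductive Tile where
  | cross (a b : Bool)
  | arm (m : Dir) (r : Option Bool) (s : Bool)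
deriving DecidableEq

instance : TopologicalSpace Tile := ⊥

instance : DiscreteTopology Tile := ⟨rfl⟩

namespace Tile

def IsCross : Tile → Prop
  | cross _ _ => True
  | arm _ _ _ => False

/-- The drawing on the side `d` of a tile. -/
def mark : Tile → Dir → Mark
  | cross a b, d =>
      ⟨true,
        if d = ⟨false, a⟩ then some ⟨true, !b⟩
        else if d = ⟨true, b⟩ then some ⟨false, !a⟩
        else none⟩
  | arm m r s, d =>
      ⟨decide (d = m),
        if d.vert = m.vert then r.map m.perp
        else if s then some m
        else none⟩

/-- The tile `u` may be placed next to `t` in the direction `d`: on their common side, each arrow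
head of one of them meets an arrow tail of the same colour of the other, and conversely. -/
def Matches (t u : Tile) (d : Dir) : Prop :=
  (t.mark d).head = !(u.mark d.opp).head ∧ (t.mark d).red = (u.mark d.opp).red

end Tile

/-- The Robinson shift: (1) arrow heads meet arrow tails; for some `k`, (2) all tiles on
`k + 2ℤ²` are crosses and (3) all other crosses lie on `k + (1,1) + 2ℤ²`. -/
def robinsonShift : Set (Config Tile 2) :=
  {x | (∀ (p : Lattice 2) (d : Dir), (x p).Matches (x (p + d.vec)) d) ∧
    ∃ k : Lattice 2,
      (∀ q : Lattice 2, (x (k + 2 • q)).IsCross) ∧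
      ∀ p : Lattice 2, (x p).IsCross →
        (∃ q : Lattice 2, p = k + 2 • q) ∨ ∃ q : Lattice 2, p = k + 1 + 2 • q}

/-! ### The group `ℤ² ⋊ D₄` -/

/-- The action of `GL_d(ℤ)` on (the multiplicatively written group) `ℤ^d`. -/
def glAction (d : ℕ) : GL (Fin d) ℤ →* MulAut (Multiplicative (Lattice d)) where
  toFun M :=
    { toFun := fun v => Multiplicative.ofAdd (M.1 *ᵥ v.toAdd)
      invFun := fun v => Multiplicative.ofAdd ((M⁻¹).1 *ᵥ v.toAdd)
      left_inv := fun v => by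
        simp only [toAdd_ofAdd, Matrix.mulVec_mulVec, ← Units.val_mul, inv_mul_cancel]
        simp
      right_inv := fun v => by
        simp only [toAdd_ofAdd, Matrix.mulVec_mulVec, ← Units.val_mul, mul_inv_cancel]
        simp
      map_mul' := fun v w => by
        simp [Matrix.mulVec_add] }
  map_one' := by
    ext v
    simp
  map_mul' M N := by
    ext v
    simp [Matrix.mulVec_mulVec]

/-- The rotation by a quarter turn. -/
def rotMatrix : Matrix (Fin 2) (Fin 2) ℤ := !![0, -1; 1, 0]

/-- The reflection that reverses the first coordinate. -/
def reflMatrix : Matrix (Fin 2) (Fin 2) ℤ := !![-1, 0; 0, 1]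

/-- The standard representation of the dihedral group of order `8` by integer matrices. -/
def dihedralMatrix : DihedralGroup 4 →* Matrix (Fin 2) (Fin 2) ℤ where
  toFun
    | .r i => rotMatrix ^ i.val
    | .sr i => reflMatrix * rotMatrix ^ i.val
  map_one' := by decide
  map_mul' := by decide

/-- The standard action of the dihedral group of order `8` on `ℤ²`. -/
def dihedralAction : DihedralGroup 4 →* MulAut (Multiplicative (Lattice 2)) :=
  (glAction 2).comp dihedralMatrix.toHomUnits

end Robinson

/-! Off the two axes an explicit tiling `hier` obeys the matching rule: a tile is a cross where both
coordinates have the same 2-adic valuation and an arm elsewhere, with directions and red arrows read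
off from binary digits. A tile depends only on its coordinates modulo a high power of 2
(`tileAt_congr`), so each pattern off the axes recurs in all large squares at the corner of the
positive quadrant. The candidate `rob` consists of the configurations all of whose finite patterns
occur there.

Uniqueness: in any point of the Robinson shift the crosses on `k + 2ℤ²` are supertiles of level 0,
and the matching rule forces facing supertiles of level `n` to combine in fours into supertiles of
level `n + 1` (`Block.facing_right`, `Block.exists_next`). So every orbit closure in the Robinson
shift contains `rob`.

Symmetries: the position of a point of `rob` in the hierarchy is a pair of 2-adic integers, and its
residue at each level is visible in a box of bounded size (`Approx.unique_of_agree`). The position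
determines all tiles except on at most one singular row and one singular column. The points
`rowPoint true` and `rowPoint false` share their position and differ exactly on one row. A symmetry
with linear part `M` is given by a local rule; it sends them to two points of equal position that
differ only near the image of this row under `M`. But such differences run along a ray in a singular
row or column (`exists_ray`). Hence `M` maps axes to axes and lies in `D₄`. With `M = 1` and the
crossing of the singular lines fixed, the local rule reproduces each pattern of `hier`, so the
symmetry is the identity (`Normal.eq_one`). Shifts and reflections realise every pair of crossing
point and element of `D₄`. -/

namespace Robinson

open Matrix

/-! ### The hierarchical tiling of the quadrants -/

/-- The exponent of `2` in an integer. -/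
def val (X : ℤ) : ℕ := padicValInt 2 X

/-- The `n`-th binary digit of an integer (in two's complement). -/
def bit (n : ℕ) (X : ℤ) : Bool := decide ((X / 2 ^ n) % 2 = 1)

/-- The default value `val 0 = 0` makes this fail at zero; this is why the axes are kept apart
throughout. -/
theorem pow_dvd_iff_le_val {X : ℤ} (hX : X ≠ 0) (n : ℕ) : (2 : ℤ) ^ n ∣ X ↔ n ≤ val X := by
  have := padicValInt_dvd_iff (p := 2) n X
  simpa [hX, val] using this

theorem ne_zero_of_not_dvd {d X : ℤ} (h : ¬ d ∣ X) : X ≠ 0 := by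
  rintro rfl; exact h (dvd_zero _)

theorem val_lt_of_not_dvd {n : ℕ} {X : ℤ} (h : ¬ (2 : ℤ) ^ n ∣ X) : val X < n := by
  rw [pow_dvd_iff_le_val (ne_zero_of_not_dvd h)] at h
  omega

theorem val_eq_of {n : ℕ} {X : ℤ} (h1 : (2 : ℤ) ^ n ∣ X) (h2 : ¬ (2 : ℤ) ^ (n + 1) ∣ X) :
    val X = n := by
  have h0 := ne_zero_of_not_dvd h2
  rw [pow_dvd_iff_le_val h0] at h1 h2
  omega

theorem pow_val_dvd (X : ℤ) : (2 : ℤ) ^ val X ∣ X := by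
  by_cases h : X = 0
  · simp [h]
  · exact (pow_dvd_iff_le_val h _).2 le_rfl

theorem val_mul_odd (n : ℕ) (c : ℤ) (hc : c % 2 = 1) : val (2 ^ n * c) = n := by
  apply val_eq_of (dvd_mul_right _ _)
  rw [pow_succ, mul_dvd_mul_iff_left (by positivity)]
  omega

theorem val_odd {X : ℤ} (h : X % 2 = 1) : val X = 0 := by
  simpa using val_mul_odd 0 X h

theorem not_dvd_of_pos_of_lt {d X : ℤ} (h1 : 0 < X) (h2 : X < d) : ¬ d ∣ X :=
  fun h => absurd (Int.le_of_dvd h1 h) (by omega)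

theorem val_neg (X : ℤ) : val (-X) = val X := by simp [val, padicValInt]

theorem ediv_add_one {d X : ℤ} (hd : 0 < d) (h : ¬ d ∣ X + 1) : (X + 1) / d = X / d := by
  have h1 := Int.emod_add_mul_ediv X d
  have h2 := Int.emod_nonneg X hd.ne'
  have h3 := Int.emod_lt_of_pos X hd
  have h4 : X % d + 1 ≠ d := fun h4 => h ⟨X / d + 1, by linarith⟩
  rw [Int.ediv_eq_iff_of_pos hd]
  constructor
  · nlinarith
  · nlinarith [lt_of_le_of_ne (show X % d + 1 ≤ d by omega) h4]

theorem ediv_of_dvd_add_one {d X : ℤ} (hd : 0 < d) (h : d ∣ X + 1) :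
    X / d = (X + 1) / d - 1 := by
  obtain ⟨c, hc⟩ := h
  rw [hc, Int.mul_ediv_cancel_left _ hd.ne', Int.ediv_eq_iff_of_pos hd]
  constructor <;> nlinarith

theorem neg_ediv_of_not_dvd {d X : ℤ} (hd : 0 < d) (h : ¬ d ∣ X) : -X / d = -(X / d) - 1 := by
  have h1 := Int.emod_add_mul_ediv X d
  have h2 := Int.emod_nonneg X hd.ne'
  have h3 := Int.emod_lt_of_pos X hd
  have h4 : X % d ≠ 0 := fun h4 => h (Int.dvd_of_emod_eq_zero h4)
  have h5 : 0 < X % d := by omega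
  rw [Int.ediv_eq_iff_of_pos hd]
  constructor <;> nlinarith

theorem bit_neg {n : ℕ} {X : ℤ} (h : ¬ (2 : ℤ) ^ n ∣ X) : bit n (-X) = !bit n X := by
  unfold bit
  rw [neg_ediv_of_not_dvd (by positivity) h, ← decide_not, decide_eq_decide]
  omega

theorem bit_add_one {n : ℕ} {X : ℤ} (h : ¬ (2 : ℤ) ^ n ∣ X + 1) : bit n (X + 1) = bit n X := by
  unfold bit
  rw [ediv_add_one (by positivity) h]

theorem bit_of_dvd_add_one {n : ℕ} {X : ℤ} (h : (2 : ℤ) ^ n ∣ X + 1) :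
    bit n X = !bit n (X + 1) := by
  unfold bit
  rw [ediv_of_dvd_add_one (by positivity) h, ← decide_not, decide_eq_decide]
  omega

theorem bit_of_pow_dvd {n : ℕ} {X : ℤ} (h : (2 : ℤ) ^ n ∣ X) :
    bit n X = !decide ((2 : ℤ) ^ (n + 1) ∣ X) := by
  obtain ⟨c, rfl⟩ := h
  unfold bit
  rw [Int.mul_ediv_cancel_left _ (by positivity), pow_succ,
    decide_eq_decide.2 (mul_dvd_mul_iff_left (by positivity)), ← decide_not, decide_eq_decide]
  omega

theorem bit_val {X : ℤ} (hX : X ≠ 0) : bit (val X) X = true := by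
  rw [bit_of_pow_dvd (pow_val_dvd X)]
  simp [pow_dvd_iff_le_val hX]

theorem bit_of_lt_val {X : ℤ} (hX : X ≠ 0) {n : ℕ} (h : n < val X) : bit n X = false := by
  rw [bit_of_pow_dvd ((pow_dvd_iff_le_val hX n).2 h.le)]
  simp [pow_dvd_iff_le_val hX]
  omega

theorem not_pow_dvd {n : ℕ} {X : ℤ} (hX : X ≠ 0) (h : val X < n) : ¬ (2 : ℤ) ^ n ∣ X := by
  rw [pow_dvd_iff_le_val hX]; omega

/-- Integers that agree modulo `2 ^ K` have the same digits below `K`. -/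
theorem bit_congr {K n : ℕ} {X X' : ℤ} (h : (2 : ℤ) ^ K ∣ X' - X) (hn : n < K) :
    bit n X' = bit n X := by
  obtain ⟨c, hc⟩ := h
  obtain ⟨e, rfl⟩ := Nat.exists_eq_add_of_lt hn
  have : X' = X + 2 ^ n * (2 * (2 ^ e * c)) := by
    rw [show X' = X + (X' - X) by ring, hc]; ring
  unfold bit
  rw [this, Int.add_mul_ediv_left _ _ (by positivity), decide_eq_decide]
  omega

theorem val_congr {K : ℕ} {X X' : ℤ} (h : (2 : ℤ) ^ K ∣ X' - X) (hX : ¬ (2 : ℤ) ^ K ∣ X) :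
    val X' = val X := by
  have h0 := ne_zero_of_not_dvd hX
  have hlt := val_lt_of_not_dvd hX
  have key : ∀ n ≤ K, ((2 : ℤ) ^ n ∣ X' ↔ 2 ^ n ∣ X) := fun n hn => by
    have h1 : (2 : ℤ) ^ n ∣ X' - X := (pow_dvd_pow 2 hn).trans h
    exact ⟨fun h2 => (dvd_sub_right h2).1 h1, fun h2 => (dvd_sub_left h2).1 h1⟩
  apply val_eq_of
  · rw [key _ hlt.le]; exact pow_val_dvd X
  · rw [key _ hlt]; exact not_pow_dvd h0 (by omega)

/-- The tile at a position off the two axes of the hierarchical tiling. -/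
def tileAt (X Y : ℤ) : Tile :=
  -- Crosses of level `n` sit at odd multiples of `2 ^ n`; digit `n + 1` tells on which side the
  -- centre of the surrounding supertile lies, and the cross faces it. An arm in a row of valuation
  -- `n` points away from the cross of level `n` in its block, to the right when digit `n` of `X` is
  -- 1. It is red on the side which that cross faces, that is, when digits `n` and `n + 1` differ.
  -- Its side arrows are red when they come from crosses exactly one level below.
  if val X = val Y then .cross (!bit (val Y + 1) X) (!bit (val Y + 1) Y)
  else if val X < val Y then
    .arm ⟨false, bit (val Y) X⟩
      (if bit (val Y) X = bit (val Y + 1) X then none else some (bit (val Y + 1) Y))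
      (decide (val X + 1 = val Y))
  else
    .arm ⟨true, bit (val X) Y⟩
      (if bit (val X) Y = bit (val X + 1) Y then none else some (bit (val X + 1) X))
      (decide (val Y + 1 = val X))

theorem tileAt_of_eq {X Y : ℤ} {n : ℕ} (hX : val X = n) (hY : val Y = n) :
    tileAt X Y = .cross (!bit (n + 1) X) (!bit (n + 1) Y) := by
  simp [tileAt, hX, hY]

theorem tileAt_of_lt {X Y : ℤ} {m n : ℕ} (hX : val X = m) (hY : val Y = n) (h : m < n) :
    tileAt X Y = .arm ⟨false, bit n X⟩
      (if bit n X = bit (n + 1) X then none else some (bit (n + 1) Y)) (decide (m + 1 = n)) := by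
  simp [tileAt, hX, hY, h, h.ne]

theorem tileAt_of_gt {X Y : ℤ} {m n : ℕ} (hX : val X = m) (hY : val Y = n) (h : n < m) :
    tileAt X Y = .arm ⟨true, bit m Y⟩
      (if bit m Y = bit (m + 1) Y then none else some (bit (m + 1) X)) (decide (n + 1 = m)) := by
  simp [tileAt, hX, hY, h.not_gt, h.ne']

theorem isCross_tileAt {X Y : ℤ} : (tileAt X Y).IsCross ↔ val X = val Y := by
  rcases lt_trichotomy (val X) (val Y) with h | h | h
  · simp [tileAt_of_lt rfl rfl h, Tile.IsCross, h.ne]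
  · simp [tileAt_of_eq h rfl, Tile.IsCross, h]
  · simp [tileAt_of_gt rfl rfl h, h.ne', Tile.IsCross]

/-- The tile depends only on the coordinates modulo a high power of `2`. -/
theorem tileAt_congr {K : ℕ} {X X' Y Y' : ℤ} (hX : ¬ (2 : ℤ) ^ K ∣ X) (hY : ¬ (2 : ℤ) ^ K ∣ Y)
    (hXX : (2 : ℤ) ^ (K + 1) ∣ X' - X) (hYY : (2 : ℤ) ^ (K + 1) ∣ Y' - Y) :
    tileAt X' Y' = tileAt X Y := by
  have hx := val_lt_of_not_dvd hX
  have hy := val_lt_of_not_dvd hY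
  have e1 := val_congr ((pow_dvd_pow 2 (Nat.le_succ K)).trans hXX) hX
  have e2 := val_congr ((pow_dvd_pow 2 (Nat.le_succ K)).trans hYY) hY
  have bx : ∀ n < K + 1, bit n X' = bit n X := fun n hn => bit_congr hXX hn
  have hy' : ∀ n < K + 1, bit n Y' = bit n Y := fun n hn => bit_congr hYY hn
  simp only [tileAt, e1, e2, bx _ (show val Y + 1 < K + 1 by omega),
    bx _ (show val Y < K + 1 by omega),
    bx _ (show val X + 1 < K + 1 by omega), hy' _ (show val Y + 1 < K + 1 by omega),
    hy' _ (show val X < K + 1 by omega), hy' _ (show val X + 1 < K + 1 by omega)]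

/-! ### Symmetries of tiles -/

namespace Dir

/-- The reflection of directions in the vertical axis. -/
def refl (d : Dir) : Dir := ⟨d.vert, if d.vert then d.pos else !d.pos⟩

/-- The reflection of directions in the diagonal. -/
def swap (d : Dir) : Dir := ⟨!d.vert, d.pos⟩

end Dir

namespace Tile

/-- The reflection of tiles in the vertical axis. -/
def refl : Tile → Tile
  | cross a b => cross (!a) b
  | arm ⟨false, p⟩ r s => arm ⟨false, !p⟩ r s
  | arm ⟨true, p⟩ r s => arm ⟨true, p⟩ (r.map not) s

/-- The reflection of tiles in the diagonal. -/
def swap : Tile → Tile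
  | cross a b => cross b a
  | arm m r s => arm m.swap r s

theorem refl_refl (t : Tile) : t.refl.refl = t := by
  rcases t with ⟨a, b⟩ | ⟨⟨_ | _, p⟩, _ | r, s⟩ <;> simp [refl]

theorem swap_swap (t : Tile) : t.swap.swap = t := by
  rcases t with ⟨a, b⟩ | ⟨⟨v, p⟩, r, s⟩ <;> simp [swap, Dir.swap]

/-- A tile is determined by the drawings on any three of its sides. -/
theorem eq_of_mark_eq (e : Dir) {t u : Tile} (h : ∀ d ≠ e, t.mark d = u.mark d) : t = u := by
  have h1 := h ⟨false, false⟩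
  have h2 := h ⟨false, true⟩
  have h3 := h ⟨true, false⟩
  have h4 := h ⟨true, true⟩
  clear h
  revert h1 h2 h3 h4
  rcases e with ⟨_ | _, _ | _⟩ <;>
  rcases t with ⟨_ | _, _ | _⟩ | ⟨⟨_ | _, _ | _⟩, _ | _ | _, _ | _⟩ <;>
  rcases u with ⟨_ | _, _ | _⟩ | ⟨⟨_ | _, _ | _⟩, _ | _ | _, _ | _⟩ <;> decide

theorem matches_refl {t u : Tile} {d : Dir} (h : t.Matches u d) : t.refl.Matches u.refl d.refl := by
  revert h
  rcases d with ⟨_ | _, _ | _⟩ <;>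
  rcases t with ⟨_ | _, _ | _⟩ | ⟨⟨_ | _, _ | _⟩, _ | _ | _, _ | _⟩ <;>
  rcases u with ⟨_ | _, _ | _⟩ | ⟨⟨_ | _, _ | _⟩, _ | _ | _, _ | _⟩ <;> unfold Matches <;> decide

theorem matches_swap {t u : Tile} {d : Dir} (h : t.Matches u d) : t.swap.Matches u.swap d.swap := by
  revert h
  rcases d with ⟨_ | _, _ | _⟩ <;>
  rcases t with ⟨_ | _, _ | _⟩ | ⟨⟨_ | _, _ | _⟩, _ | _ | _, _ | _⟩ <;>
  rcases u with ⟨_ | _, _ | _⟩ | ⟨⟨_ | _, _ | _⟩, _ | _ | _, _ | _⟩ <;> unfold Matches <;> decide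

theorem Matches.symm {t u : Tile} {d : Dir} (h : t.Matches u d) : u.Matches t d.opp := by
  have : d.opp.opp = d := by simp [Dir.opp]
  unfold Matches at *
  rw [this, h.1, h.2]
  simp

end Tile

theorem tileAt_swap (X Y : ℤ) : tileAt Y X = (tileAt X Y).swap := by
  rcases lt_trichotomy (val X) (val Y) with h | h | h
  · rw [tileAt_of_lt rfl rfl h, tileAt_of_gt rfl rfl h]; rfl
  · rw [tileAt_of_eq h rfl, tileAt_of_eq rfl h]; rfl
  · rw [tileAt_of_gt rfl rfl h, tileAt_of_lt rfl rfl h]; rfl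

theorem tileAt_refl {X : ℤ} (hX : X ≠ 0) (Y : ℤ) : tileAt (-X) Y = (tileAt X Y).refl := by
  have hb : ∀ n, val X < n → bit n (-X) = !bit n X := fun n hn => bit_neg (not_pow_dvd hX hn)
  have hv := val_neg X
  rcases lt_trichotomy (val X) (val Y) with h | h | h
  · rw [tileAt_of_lt rfl rfl h, tileAt_of_lt hv rfl h, hb _ h, hb _ (by omega)]
    simp [Tile.refl]
  · rw [tileAt_of_eq h rfl, tileAt_of_eq (hv.trans h) rfl, hb _ (by omega)]
    simp [Tile.refl]
  · rw [tileAt_of_gt rfl rfl h, tileAt_of_gt hv rfl h, hb _ (by omega)]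
    simp only [Tile.refl]
    split_ifs <;> simp

/-- Passing from `X` to `X + 1` flips the digits up to position `m = val (X + 1)` and keeps those
above. Comparing `m` with `n = val Y` then settles which two kinds of tile meet. -/
theorem tileAt_matches_right_of_odd {X : ℤ} (hX : X % 2 = 1) (hX1 : X + 1 ≠ 0) (Y : ℤ) :
    (tileAt X Y).Matches (tileAt (X + 1) Y) ⟨false, true⟩ := by
  have v0 : val X = 0 := val_odd hX
  have hX0 : X ≠ 0 := by rintro rfl; simp at hX
  have hm : 1 ≤ val (X + 1) := (pow_dvd_iff_le_val hX1 1).1 (by omega)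
  generalize hmm : val (X + 1) = m at hm
  generalize hn : val Y = n
  have same : ∀ i, m < i → bit i X = bit i (X + 1) := fun i hi =>
    (bit_add_one (not_pow_dvd hX1 (by omega))).symm
  have flip : ∀ i, i ≤ m → bit i X = !bit i (X + 1) := fun i hi =>
    bit_of_dvd_add_one ((pow_dvd_iff_le_val hX1 i).2 (by omega))
  have bm : bit m (X + 1) = true := hmm ▸ bit_val hX1
  have blt : ∀ i, i < m → bit i (X + 1) = false := fun i hi => bit_of_lt_val hX1 (by omega)
  rcases Nat.eq_zero_or_pos n with rfl | hn0
  · rw [tileAt_of_eq v0 hn, tileAt_of_gt hmm hn hm]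
    rcases eq_or_lt_of_le hm with rfl | h1
    · simp [Tile.Matches, Tile.mark, Dir.opp, flip 1 le_rfl, bm]
    · simp [Tile.Matches, Tile.mark, Dir.opp, flip 1 hm, blt 1 h1, h1.ne]
  · rw [tileAt_of_lt v0 hn hn0]
    rcases lt_trichotomy m n with h | rfl | h
    · rw [tileAt_of_lt hmm hn h, same n h, same (n + 1) (by omega)]
      cases hb : bit n (X + 1) <;> simp [Tile.Matches, Tile.mark, Dir.opp]
    · rw [tileAt_of_eq hmm hn, flip m le_rfl, bm, same (m + 1) (by omega)]
      cases hb : bit (m + 1) (X + 1) <;> simp [Tile.Matches, Tile.mark, Dir.opp, Dir.perp]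
    · rw [tileAt_of_gt hmm hn h, flip n h.le, blt n h, flip (n + 1) h]
      rcases eq_or_lt_of_le (show n + 1 ≤ m from h) with rfl | h1
      · simp [bm, Tile.Matches, Tile.mark, Dir.opp, Dir.perp]
      · simp [blt _ h1, h1.ne, Tile.Matches, Tile.mark, Dir.opp]

theorem tileAt_matches_right {X : ℤ} (hX : X ≠ 0) (hX1 : X + 1 ≠ 0) (Y : ℤ) :
    (tileAt X Y).Matches (tileAt (X + 1) Y) ⟨false, true⟩ := by
  rcases Int.emod_two_eq_zero_or_one X with h | h
  -- For even `X` the number `-(X + 1)` is odd, and reflection exchanges the two tiles.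
  · have := tileAt_matches_right_of_odd (X := -(X + 1)) (by omega) (by omega) Y
    rw [tileAt_refl hX1, show -(X + 1) + 1 = -X by ring, tileAt_refl hX] at this
    simpa [Tile.refl_refl, Dir.refl, Dir.opp] using (Tile.matches_refl this).symm
  · exact tileAt_matches_right_of_odd h hX1 Y

theorem tileAt_matches {X Y : ℤ} (d : Dir) (hX : X ≠ 0) (hY : Y ≠ 0) (hX1 : X + d.vec 0 ≠ 0)
    (hY1 : Y + d.vec 1 ≠ 0) :
    (tileAt X Y).Matches (tileAt (X + d.vec 0) (Y + d.vec 1)) d := by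
  rcases d with ⟨_ | _, _ | _⟩ <;> simp [Dir.vec] at hX1 hY1 ⊢
  · have := tileAt_matches_right hX1 (by simpa using hX) Y
    simpa [Dir.opp] using this.symm
  · exact tileAt_matches_right hX hX1 Y
  · have := (Tile.matches_swap (tileAt_matches_right hY1 (by simpa using hY) X)).symm
    simpa [Dir.opp, Dir.swap, ← tileAt_swap] using this
  · have := Tile.matches_swap (tileAt_matches_right hY hY1 X)
    simpa [Dir.opp, Dir.swap, ← tileAt_swap] using this

/-! ### Configurations and boxes -/

instance : Finite Tile := by
  refine Finite.of_surjective
    (Sum.elim (fun p : Bool × Bool => Tile.cross p.1 p.2)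
      (fun p : Dir × Option Bool × Bool => Tile.arm p.1 p.2.1 p.2.2)) ?_
  rintro (⟨a, b⟩ | ⟨m, r, s⟩)
  · exact ⟨.inl (a, b), rfl⟩
  · exact ⟨.inr (m, r, s), rfl⟩

/-- The points of the lattice whose coordinates are at most `N` in absolute value. -/
def box (N : ℕ) : Set (Lattice 2) := {p | ∀ i, |p i| ≤ N}

theorem finite_box (N : ℕ) : (box N).Finite :=
  (Set.finite_Icc (fun _ : Fin 2 => -(N : ℤ)) (fun _ => (N : ℤ))).subset fun _ hp =>
    ⟨fun i => (abs_le.1 (hp i)).1, fun i => (abs_le.1 (hp i)).2⟩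

theorem box_mono {N N' : ℕ} (h : N ≤ N') : box N ⊆ box N' :=
  fun _ hp i => (hp i).trans (by exact_mod_cast h)

theorem exists_mem_box (p : Lattice 2) : ∃ N, p ∈ box N :=
  ⟨(p 0).natAbs + (p 1).natAbs, fun i => by fin_cases i <;> simp⟩

theorem isOpen_cylinder (N : ℕ) (y : Config Tile 2) :
    IsOpen {z : Config Tile 2 | ∀ p ∈ box N, z p = y p} := by
  have : {z : Config Tile 2 | ∀ p ∈ box N, z p = y p} =
      ⋂ p ∈ box N, (fun z : Config Tile 2 => z p) ⁻¹' {y p} := by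
    ext z; simp
  rw [this]
  exact (finite_box N).isOpen_biInter fun p _ =>
    (isOpen_discrete _).preimage (continuous_apply p)

theorem exists_cylinder_subset {U : Set (Config Tile 2)} (hU : IsOpen U) {y : Config Tile 2}
    (hy : y ∈ U) : ∃ N, ∀ z : Config Tile 2, (∀ p ∈ box N, z p = y p) → z ∈ U := by
  obtain ⟨I, u, h1, h2⟩ := isOpen_pi_iff.1 hU y hy
  choose N hN using exists_mem_box
  refine ⟨I.sup N, fun z hz => h2 fun p hp => ?_⟩
  rw [hz p (box_mono (Finset.le_sup (f := N) hp) (hN p))]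
  exact (h1 p hp).2

theorem mem_closure_of_cylinders {S : Set (Config Tile 2)} {y : Config Tile 2}
    (h : ∀ N, ∃ z ∈ S, ∀ p ∈ box N, z p = y p) : y ∈ closure S := by
  rw [mem_closure_iff]
  intro U hU hy
  obtain ⟨N, hN⟩ := exists_cylinder_subset hU hy
  obtain ⟨z, hz, hzy⟩ := h N
  exact ⟨z, hN z hzy, hz⟩

/-- A continuous map of a subshift is determined at the origin by the tiles in some box. -/
theorem exists_radius (X : Subshift Tile 2) {f : X.carrier → X.carrier} (hf : Continuous f) :
    ∃ R, ∀ x y : X.carrier, (∀ p ∈ box R, x.1 p = y.1 p) → (f x).1 0 = (f y).1 0 := by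
  have hg : Continuous fun x : X.carrier => (f x).1 0 :=
    (continuous_apply 0).comp (continuous_subtype_val.comp hf)
  have hc : CompactSpace X.carrier := isCompact_iff_compactSpace.1 X.isClosed.isCompact
  have key : ∀ x : X.carrier, ∃ N, ∀ z : X.carrier,
      (∀ p ∈ box N, z.1 p = x.1 p) → (f z).1 0 = (f x).1 0 := by
    intro x
    obtain ⟨V, hV, hV'⟩ := isOpen_induced_iff.1 ((isOpen_discrete {(f x).1 0}).preimage hg)
    have hxV : x.1 ∈ V := by
      have : x ∈ Subtype.val ⁻¹' V := hV' ▸ rfl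
      exact this
    obtain ⟨N, hN⟩ := exists_cylinder_subset hV hxV
    refine ⟨N, fun z hz => ?_⟩
    have : z ∈ Subtype.val ⁻¹' V := hN z.1 hz
    rw [hV'] at this
    exact this
  choose N hN using key
  obtain ⟨t, ht⟩ := isCompact_univ.elim_finite_subcover
    (fun x : X.carrier => Subtype.val ⁻¹' {z : Config Tile 2 | ∀ p ∈ box (N x), z p = x.1 p})
    (fun x => (isOpen_cylinder (N x) x.1).preimage continuous_subtype_val)
    (fun x _ => Set.mem_iUnion.2 ⟨x, fun _ _ => rfl⟩)
  refine ⟨t.sup N, fun x y hxy => ?_⟩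
  obtain ⟨w, hw, hxw⟩ := Set.mem_iUnion₂.1 (ht (Set.mem_univ x))
  rw [hN w x hxw, hN w y fun p hp => ?_]
  rw [← hxy p (box_mono (Finset.le_sup (f := N) hw) hp)]
  exact hxw p hp

/-! ### The subshift generated by the hierarchical tiling -/

/-- The hierarchical tiling; its values on the two axes are irrelevant. -/
def hier : Config Tile 2 := fun q => tileAt (q 0) (q 1)

theorem hier_congr {K : ℕ} {q q' : Lattice 2} (h : ∀ i, ¬ (2 : ℤ) ^ K ∣ q i)
    (h' : ∀ i, (2 : ℤ) ^ (K + 1) ∣ q' i - q i) : hier q' = hier q :=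
  tileAt_congr (h 0) (h 1) (h' 0) (h' 1)

theorem hier_matches {q : Lattice 2} (d : Dir) (h : ∀ i, q i ≠ 0)
    (hd : ∀ i, (q + d.vec) i ≠ 0) : (hier q).Matches (hier (q + d.vec)) d :=
  tileAt_matches d (h 0) (h 1) (hd 0) (hd 1)

/-- In the box of size `N`, the configuration `x` shows the hierarchical tiling around `u`. -/
def Window (x : Config Tile 2) (N : ℕ) (u : Lattice 2) : Prop :=
  ∀ p ∈ box N, (∀ i, (u + p) i ≠ 0) ∧ x p = hier (u + p)

theorem Window.mono {x : Config Tile 2} {N N' : ℕ} {u : Lattice 2} (h : Window x N' u)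
    (hN : N ≤ N') : Window x N u := fun p hp => h p (box_mono hN hp)

/-- The subshift of all configurations whose finite patterns occur in the hierarchical tiling. -/
def rob : Subshift Tile 2 where
  carrier := {x | ∀ N, ∃ u, Window x N u}
  isClosed := by
    rw [← isOpen_compl_iff, isOpen_iff_mem_nhds]
    intro x hx
    simp only [Set.mem_compl_iff, Set.mem_ofPred_eq, not_forall] at hx
    obtain ⟨N, hN⟩ := hx
    refine Filter.mem_of_superset ((isOpen_cylinder N x).mem_nhds fun _ _ => rfl) fun z hz hz' => ?_
    obtain ⟨u, hu⟩ := hz' N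
    exact hN ⟨u, fun p hp => ⟨(hu p hp).1, (hz p hp).symm.trans (hu p hp).2⟩⟩
  shift_mem := by
    intro v x hx N
    obtain ⟨N', hv⟩ := exists_mem_box v
    obtain ⟨u, hu⟩ := hx (N + N')
    refine ⟨u - v, fun p hp => ?_⟩
    have e : u - v + p = u + (p - v) := by abel
    rw [e]
    refine hu (p - v) fun i => ?_
    have := abs_sub (p i) (v i)
    have h1 := hp i
    have h2 := hv i
    simp only [Pi.sub_apply, Nat.cast_add]
    linarith

/-- The windows can be chosen in a fixed residue class. -/
theorem exists_window_congr {x : Config Tile 2} (hx : x ∈ rob.carrier) (m : ℕ) [NeZero m] :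
    ∃ u : Lattice 2, ∀ N, ∃ u', (∀ i, (m : ℤ) ∣ u' i - u i) ∧ Window x N u' := by
  by_contra hcon
  push Not at hcon
  choose N hN using hcon
  -- Pigeonhole: if each of the finitely many classes failed at some size, a window of the largest
  -- of these sizes could lie in no class.
  obtain ⟨u', hu'⟩ := hx ((Finset.univ : Finset (Fin 2 → Fin m)).sup
    fun r => N fun i => ((r i : ℕ) : ℤ))
  have hm : (0 : ℤ) < m := by exact_mod_cast NeZero.pos m
  let r : Fin 2 → Fin m := fun i => ⟨(u' i % m).toNat, by
    have := Int.emod_lt_of_pos (u' i) hm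
    have := Int.emod_nonneg (u' i) hm.ne'
    omega⟩
  refine hN (fun i => ((r i : ℕ) : ℤ)) u' (fun i => ?_) (hu'.mono
    (Finset.le_sup (f := fun r : Fin 2 → Fin m => N fun i => ((r i : ℕ) : ℤ)) (Finset.mem_univ r)))
  have : ((r i : ℕ) : ℤ) = u' i % m := Int.toNat_of_nonneg (Int.emod_nonneg _ hm.ne')
  rw [this]
  exact Int.dvd_self_sub_emod

theorem rob_subset_robinsonShift : rob.carrier ⊆ robinsonShift := by
  intro x hx
  refine ⟨fun p d => ?_, ?_⟩
  · obtain ⟨N, hN⟩ := exists_mem_box p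
    obtain ⟨N', hN'⟩ := exists_mem_box (p + d.vec)
    obtain ⟨u, hu⟩ := hx (max N N')
    have h1 := hu p (box_mono (le_max_left _ _) hN)
    have h2 := hu (p + d.vec) (box_mono (le_max_right _ _) hN')
    rw [h1.2, h2.2, ← add_assoc]
    rw [← add_assoc] at h2
    exact hier_matches d h1.1 h2.1
  · obtain ⟨u, hu⟩ := exists_window_congr hx 2
    have key : ∀ p : Lattice 2, ∃ u' : Lattice 2, (∀ i, (2 : ℤ) ∣ u' i - u i) ∧
        (∀ i, (u' + p) i ≠ 0) ∧ x p = hier (u' + p) := fun p => by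
      obtain ⟨N, hN⟩ := exists_mem_box p
      obtain ⟨u', h1, h2⟩ := hu N
      exact ⟨u', by simpa using h1, h2 p hN⟩
    -- This choice puts the positions with both hierarchical coordinates odd on `k + 2ℤ²`; all other
    -- crosses have both coordinates even.
    refine ⟨1 - u, fun q => ?_, fun p hp => ?_⟩
    · obtain ⟨u', h1, -, h3⟩ := key (1 - u + 2 • q)
      rw [h3]
      have hv : ∀ i, val ((u' + (1 - u + 2 • q) : Lattice 2) i) = 0 := fun i => val_odd <| by
        have := h1 i
        have e : (u' + (1 - u + 2 • q) : Lattice 2) i = u' i - u i + 2 * q i + 1 := by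
          simp; ring
        rw [e]
        omega
      exact isCross_tileAt.2 ((hv 0).trans (hv 1).symm)
    · obtain ⟨u', h1, h2, h3⟩ := key p
      rw [h3] at hp
      have hv : val ((u' + p) 0) = val ((u' + p) 1) := isCross_tileAt.1 hp
      have e : (2 : ℤ) ∣ (u' + p) 0 ↔ (2 : ℤ) ∣ (u' + p) 1 := by
        have a0 := pow_dvd_iff_le_val (h2 0) 1
        have a1 := pow_dvd_iff_le_val (h2 1) 1
        rw [pow_one] at a0 a1
        rw [a0, a1, hv]
      have h10 := h1 0
      have h11 := h1 1
      simp only [Pi.add_apply] at e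
      by_cases hd : (2 : ℤ) ∣ u' 0 + p 0
      · have hd' := e.1 hd
        refine .inr ⟨fun i => (p i + u i - 2) / 2, ?_⟩
        ext i
        fin_cases i <;> simp <;> omega
      · have hd' := fun h => hd (e.2 h)
        refine .inl ⟨fun i => (p i + u i - 1) / 2, ?_⟩
        ext i
        fin_cases i <;> simp <;> omega

/-- A configuration that contains arbitrarily large squares of the hierarchical tiling, with a
corner at the origin, has all points of `rob` in its orbit closure. -/
theorem rob_subset_closure {x : Config Tile 2}
    (h : ∀ n : ℕ, ∃ w : Lattice 2, ∀ p : Lattice 2, (∀ i, 0 < p i ∧ p i < 2 ^ n) →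
      x (w + p) = hier p) :
    rob.carrier ⊆ closure (Set.range fun v : Lattice 2 => shift v x) := by
  intro y hy
  apply mem_closure_of_cylinders
  intro N
  obtain ⟨u, hu⟩ := hy N
  obtain ⟨N', hN'⟩ := exists_mem_box u
  have hlt : ((N + N' : ℕ) : ℤ) < 2 ^ (N + N') := by exact_mod_cast Nat.lt_two_pow_self
  obtain ⟨w, hw⟩ := h (N + N' + 3)
  -- The window around `u` has nonzero coordinates below `2 ^ (N + N')` in absolute value. Adding `2
  -- ^ (N + N' + 1)` moves it into the positive quadrant without changing its tiles.
  refine ⟨_, ⟨-(w + (u + fun _ => 2 ^ (N + N' + 1))), rfl⟩, fun p hp => ?_⟩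
  have hb : ∀ i, |(u + p) i| < 2 ^ (N + N') := fun i => by
    have := abs_add_le (u i) (p i)
    have h1 := hp i
    have h2 := hN' i
    simp only [Pi.add_apply]
    push_cast at hlt
    linarith
  have e : p - -(w + (u + fun _ => 2 ^ (N + N' + 1))) = w + (u + p + fun _ => 2 ^ (N + N' + 1)) := by
    abel
  change x _ = _
  rw [e, hw _ fun i => ?_, (hu p hp).2]
  · refine hier_congr (K := N + N') (fun i hd => ?_) fun i => by simp
    have := Int.le_of_dvd (abs_pos.2 ((hu p hp).1 i)) ((dvd_abs _ _).2 hd)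
    have := hb i
    omega
  · have := abs_lt.1 (hb i)
    have h0 : (0 : ℤ) < 2 ^ (N + N') := by positivity
    have e1 : (2 : ℤ) ^ (N + N' + 1) = 2 * 2 ^ (N + N') := by ring
    have e3 : (2 : ℤ) ^ (N + N' + 3) = 8 * 2 ^ (N + N') := by ring
    rw [Pi.add_apply, e1, e3]
    constructor <;> linarith

/-! ### Recognizability -/

/-- Modulo `2 ^ (n + 3)`, the position of `x` in the hierarchy is `u`. -/
def Approx (n : ℕ) (x : Config Tile 2) (u : Lattice 2) : Prop :=
  ∀ p : Lattice 2, (∀ i, ¬ (2 : ℤ) ^ (n + 2) ∣ (u + p) i) → x p = hier (u + p)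

theorem Approx.mono {m n : ℕ} {x : Config Tile 2} {u : Lattice 2} (h : Approx n x u) (hm : m ≤ n) :
    Approx m x u :=
  fun p hp => h p fun i hd => hp i ((pow_dvd_pow 2 (by omega)).trans hd)

theorem Approx.congr {n : ℕ} {x : Config Tile 2} {u u' : Lattice 2} (h : Approx n x u)
    (hu : ∀ i, (2 : ℤ) ^ (n + 3) ∣ u' i - u i) : Approx n x u' := by
  intro p hp
  have hp' : ∀ i, ¬ (2 : ℤ) ^ (n + 2) ∣ (u + p) i := fun i hd => hp i <| by
    have h1 := (pow_dvd_pow (2 : ℤ) (show n + 2 ≤ n + 3 by omega)).trans (hu i)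
    have h2 : (u' + p) i = (u + p) i + (u' i - u i) := by simp; ring
    rw [h2]
    exact dvd_add hd h1
  rw [h p hp']
  exact (hier_congr hp' fun i => by simpa using hu i).symm

theorem exists_approx {x : Config Tile 2} (hx : x ∈ rob.carrier) (n : ℕ) : ∃ u, Approx n x u := by
  obtain ⟨u, hu⟩ := exists_window_congr hx (2 ^ (n + 3))
  refine ⟨u, fun p hp => ?_⟩
  obtain ⟨N, hN⟩ := exists_mem_box p
  obtain ⟨u', h1, h2⟩ := hu N
  rw [(h2 p hN).2]
  exact hier_congr hp fun i => by simpa using h1 i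

theorem exists_near_congr (c u r : Lattice 2) {m : ℤ} (hm : 0 < m) :
    ∃ p : Lattice 2, (∀ i, 0 ≤ p i - c i ∧ p i - c i < m) ∧ ∀ i, m ∣ (u + p) i - r i := by
  refine ⟨fun i => c i + (r i - u i - c i) % m, fun i => ?_, fun i => ?_⟩
  · have := Int.emod_nonneg (r i - u i - c i) hm.ne'
    have := Int.emod_lt_of_pos (r i - u i - c i) hm
    constructor <;> linarith
  · have := Int.dvd_self_sub_emod (x := r i - u i - c i) (m := m)
    have h2 : (u + fun i => c i + (r i - u i - c i) % m) i - r i =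
      -(r i - u i - c i - (r i - u i - c i) % m) := by simp; ring
    rw [h2]
    exact (dvd_neg).2 this

theorem val_two_mod_four {X : ℤ} (h : X % 4 = 2) : val X = 1 :=
  val_eq_of (by omega) (by omega)

theorem val_order_of_hier_eq {q q' : Lattice 2} (h : hier q = hier q') :
    (val (q 0) < val (q 1) ↔ val (q' 0) < val (q' 1)) ∧
      (val (q 1) < val (q 0) ↔ val (q' 1) < val (q' 0)) := by
  unfold hier at h
  rcases lt_trichotomy (val (q 0)) (val (q 1)) with h1 | h1 | h1 <;>
  rcases lt_trichotomy (val (q' 0)) (val (q' 1)) with h2 | h2 | h2 <;>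
  first
  | rw [tileAt_of_lt rfl rfl h1] at h
  | rw [tileAt_of_eq h1 rfl] at h
  | rw [tileAt_of_gt rfl rfl h1] at h
  all_goals first
  | rw [tileAt_of_lt rfl rfl h2] at h
  | rw [tileAt_of_eq h2 rfl] at h
  | rw [tileAt_of_gt rfl rfl h2] at h
  all_goals first
  | omega
  | simp at h

/-- Two configurations that agree on a large box have the same position in the hierarchy. -/
theorem Approx.unique_of_agree {n : ℕ} {x y : Config Tile 2} {u u' c : Lattice 2}
    (hx : Approx n x u) (hy : Approx n y u')
    (h : ∀ p : Lattice 2, (∀ i, 0 ≤ p i - c i ∧ p i - c i < 2 ^ (n + 2)) → x p = y p) (i : Fin 2) :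
    (2 : ℤ) ^ (n + 3) ∣ u' i - u i := by
  have h4 : (4 : ℤ) ∣ 2 ^ (n + 2) := ⟨2 ^ n, by ring⟩
  have h4' : (4 : ℤ) ≤ 2 ^ (n + 2) := Int.le_of_dvd (by positivity) h4
  -- Nonzero residues modulo 4 keep both positions off the multiples of `2 ^ (n + 2)`, so both
  -- approximations apply there.
  have mod4 : ∀ r : Lattice 2, (∀ i, r i % 4 ≠ 0) → (∀ i, (r i + (u' i - u i)) % 4 ≠ 0) →
      ∃ q q' : Lattice 2, hier q = hier q' ∧ (∀ i, q i % 4 = r i % 4) ∧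
        ∀ i, q' i % 4 = (r i + (u' i - u i)) % 4 := by
    intro r h1 h2
    obtain ⟨p, hp1, hp2⟩ := exists_near_congr c u r (m := 4) (by norm_num)
    have e1 : ∀ i, (u + p) i % 4 = r i % 4 := fun i => by
      have := hp2 i
      omega
    have e2 : ∀ i, (u' + p) i % 4 = (r i + (u' i - u i)) % 4 := fun i => by
      have := hp2 i
      simp only [Pi.add_apply] at this ⊢
      omega
    refine ⟨u + p, u' + p, ?_, e1, e2⟩
    rw [← hx p fun i hd => ?_, ← hy p fun i hd => ?_]
    · exact h p fun i => ⟨(hp1 i).1, (hp1 i).2.trans_le h4'⟩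
    · exact h2 i ((e2 i) ▸ Int.emod_eq_zero_of_dvd (h4.trans hd))
    · exact h1 i ((e1 i) ▸ Int.emod_eq_zero_of_dvd (h4.trans hd))
  have step : ∀ j, j ≤ n + 2 → ∀ i, (2 : ℤ) ^ (j + 1) ∣ u' i - u i := by
    intro j
    induction j with
    | zero =>
      intro _ i
      have goal : (u' 0 - u 0) % 2 = 0 ∧ (u' 1 - u 1) % 2 = 0 := by
        by_contra hcon
        rcases Int.emod_two_eq_zero_or_one (u' 0 - u 0) with h0 | h0 <;>
        rcases Int.emod_two_eq_zero_or_one (u' 1 - u 1) with h1 | h1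
        · exact hcon ⟨h0, h1⟩
        -- The second entry is odd and is moved to 2 modulo 4, so a cross would coincide with an
        -- arm.
        · obtain ⟨q, q', e, e1, e2⟩ := mod4 ![1, 2 - (u' 1 - u 1)]
            (by intro i; fin_cases i <;> simp; omega) (by intro i; fin_cases i <;> simp; omega)
          have a1 := e1 0
          have a2 := e1 1
          have a3 := e2 0
          have a4 := e2 1
          simp at a1 a2 a3 a4
          have := val_order_of_hier_eq e
          rw [val_odd (X := q 0) (by omega), val_odd (X := q 1) (by omega),
            val_odd (X := q' 0) (by omega), val_two_mod_four (X := q' 1) (by omega)] at this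
          simp at this
        · obtain ⟨q, q', e, e1, e2⟩ := mod4 ![2 - (u' 0 - u 0), 1]
            (by intro i; fin_cases i <;> simp; omega) (by intro i; fin_cases i <;> simp; omega)
          have a1 := e1 0
          have a2 := e1 1
          have a3 := e2 0
          have a4 := e2 1
          simp at a1 a2 a3 a4
          have := val_order_of_hier_eq e
          rw [val_odd (X := q 0) (by omega), val_odd (X := q 1) (by omega),
            val_odd (X := q' 1) (by omega), val_two_mod_four (X := q' 0) (by omega)] at this
          simp at this
        -- Here a vertical arm would coincide with a horizontal one.
        · obtain ⟨q, q', e, e1, e2⟩ := mod4 ![2, 2 - (u' 1 - u 1)]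
            (by intro i; fin_cases i <;> simp; omega) (by intro i; fin_cases i <;> simp; omega)
          have a1 := e1 0
          have a2 := e1 1
          have a3 := e2 0
          have a4 := e2 1
          simp at a1 a2 a3 a4
          have := val_order_of_hier_eq e
          rw [val_two_mod_four (X := q 0) (by omega), val_odd (X := q 1) (by omega),
            val_odd (X := q' 0) (by omega), val_two_mod_four (X := q' 1) (by omega)] at this
          simp at this
      fin_cases i <;> simp <;> omega
    | succ j ih =>
      intro hj
      have ih := ih (by omega)
      -- At an odd multiple of `2 ^ j` in both coordinates there is a cross of level `j`. Its
      -- orientation shows digit `j + 1`, one more digit of the position.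
      obtain ⟨p, hp1, hp2⟩ := exists_near_congr c u (fun _ => 2 ^ j) (m := 2 ^ (j + 1))
        (by positivity)
      have v : ∀ X : ℤ, (2 : ℤ) ^ (j + 1) ∣ X - 2 ^ j → val X = j ∧ ¬ (2 : ℤ) ^ (n + 2) ∣ X := by
        rintro X ⟨k, hk⟩
        have hX : X = 2 ^ j * (2 * k + 1) := by
          rw [show X = X - 2 ^ j + 2 ^ j by ring, hk]; ring
        have hv : val X = j := hX ▸ val_mul_odd j _ (by omega)
        have hX0 : X ≠ 0 := by
          rw [hX]
          exact mul_ne_zero (by positivity) (by omega)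
        exact ⟨hv, not_pow_dvd hX0 (by omega)⟩
      have v1 : ∀ i, val ((u + p) i) = j ∧ ¬ (2 : ℤ) ^ (n + 2) ∣ (u + p) i := fun i => v _ (hp2 i)
      have v2 : ∀ i, val ((u' + p) i) = j ∧ ¬ (2 : ℤ) ^ (n + 2) ∣ (u' + p) i := fun i => v _ <| by
        have := dvd_add (hp2 i) (ih i)
        have e : (u' + p) i - 2 ^ j = (u + p) i - 2 ^ j + (u' i - u i) := by simp; ring
        rwa [e]
      have e : hier (u + p) = hier (u' + p) := by
        rw [← hx p fun i => (v1 i).2, ← hy p fun i => (v2 i).2]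
        refine h p fun i => ⟨(hp1 i).1, (hp1 i).2.trans_le ?_⟩
        exact pow_le_pow_right₀ (by norm_num) (by omega)
      unfold hier at e
      rw [tileAt_of_eq (v1 0).1 (v1 1).1, tileAt_of_eq (v2 0).1 (v2 1).1] at e
      have e' : ∀ i, bit (j + 1) ((u + p) i) = bit (j + 1) ((u' + p) i) := by
        simp only [Tile.cross.injEq, Bool.not_inj_iff] at e
        intro i
        fin_cases i
        · exact e.1
        · exact e.2
      intro i
      obtain ⟨k, hk⟩ := ih i
      have e2 : (u' + p) i = (u + p) i + 2 ^ (j + 1) * k := by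
        rw [← hk]; simp; ring
      have e3 := e' i
      unfold bit at e3
      rw [e2, Int.add_mul_ediv_left _ _ (by positivity), decide_eq_decide] at e3
      obtain ⟨l, hl⟩ : (2 : ℤ) ∣ k := by omega
      exact ⟨l, by rw [hk, hl]; ring⟩
  exact step (n + 2) le_rfl i

theorem Approx.unique {n : ℕ} {x : Config Tile 2} {u u' : Lattice 2}
    (hx : Approx n x u) (hy : Approx n x u') (i : Fin 2) : (2 : ℤ) ^ (n + 3) ∣ u' i - u i :=
  hx.unique_of_agree hy (c := 0) (fun _ _ => rfl) i

theorem rob_subset_closure_of_mem {x : Config Tile 2} (hx : x ∈ rob.carrier) :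
    rob.carrier ⊆ closure (Set.range fun v : Lattice 2 => shift v x) := by
  apply rob_subset_closure
  intro n
  obtain ⟨u, hu⟩ := exists_approx hx n
  refine ⟨-u, fun p hp => ?_⟩
  rw [hu (-u + p), add_neg_cancel_left]
  intro i
  rw [add_neg_cancel_left]
  refine not_dvd_of_pos_of_lt (hp i).1 ((hp i).2.trans_le ?_)
  exact pow_le_pow_right₀ (by norm_num) (by omega)

/-! ### Supertiles in the Robinson shift -/

namespace Tile

theorem eq_of_matches (e : Dir) {t t' : Tile} {nb : Dir → Tile}
    (h : ∀ d ≠ e, t.Matches (nb d) d) (h' : ∀ d ≠ e, t'.Matches (nb d) d) : t = t' := by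
  refine eq_of_mark_eq e fun d hd => ?_
  have h1 := h d hd
  have h2 := h' d hd
  cases h3 : t.mark d
  cases h4 : t'.mark d
  simp_all [Matches]

/-- Two opposite tails are the two side arrows of an arm, whose red companions come together and
with the same displacement. -/
theorem red_eq_of_tails {t : Tile} (h1 : (t.mark ⟨false, false⟩).head = false)
    (h2 : (t.mark ⟨false, true⟩).head = false) :
    (t.mark ⟨false, false⟩).red = (t.mark ⟨false, true⟩).red := by
  revert h1 h2
  rcases t with ⟨_ | _, _ | _⟩ | ⟨⟨_ | _, _ | _⟩, _ | _ | _, _ | _⟩ <;> decide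

/-- The red companion of a side arrow is displaced in the direction of the main arrow, so it reveals
this direction. -/
theorem left_of_red_left {t : Tile} (h1 : (t.mark ⟨true, false⟩) = ⟨false, some ⟨false, false⟩⟩)
    (h2 : (t.mark ⟨true, true⟩).head = false) : (t.mark ⟨false, true⟩).head = false := by
  revert h1 h2
  rcases t with ⟨_ | _, _ | _⟩ | ⟨⟨_ | _, _ | _⟩, _ | _ | _, _ | _⟩ <;> decide

theorem tail_of_head_of_tail {t : Tile} (d e f : Dir) (hd : (t.mark d).head = true)
    (he : (t.mark e).head = false) (hf : f ≠ d) : (t.mark f).head = false := by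
  rcases t with ⟨a, b⟩ | ⟨m, r, s⟩
  · simp [mark] at he
  · simp only [mark, decide_eq_true_eq, decide_eq_false_iff_not] at hd ⊢
    rwa [← hd]

theorem not_down_of_red_up {t : Tile} (h1 : (t.mark ⟨false, false⟩) = ⟨false, some ⟨true, true⟩⟩)
    (h2 : (t.mark ⟨true, false⟩).head = true) : False := by
  revert h1 h2
  rcases t with ⟨_ | _, _ | _⟩ | ⟨⟨_ | _, _ | _⟩, _ | _ | _, _ | _⟩ <;> decide

theorem isCross_of_heads {t : Tile} (h1 : (t.mark ⟨false, false⟩).head = true)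
    (h2 : (t.mark ⟨false, true⟩).head = true) : ∃ a b, t = cross a b := by
  rcases t with ⟨a, b⟩ | ⟨m, r, s⟩
  · exact ⟨a, b, rfl⟩
  · simp only [mark, decide_eq_true_eq] at h1 h2
    rw [← h2] at h1
    simp at h1

theorem mark_refl (t : Tile) (d : Dir) :
    t.refl.mark d.refl = ⟨(t.mark d).head, (t.mark d).red.map Dir.refl⟩ := by
  rcases d with ⟨_ | _, _ | _⟩ <;>
  rcases t with ⟨_ | _, _ | _⟩ | ⟨⟨_ | _, _ | _⟩, _ | _ | _, _ | _⟩ <;> decide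

theorem mark_swap (t : Tile) (d : Dir) :
    t.swap.mark d.swap = ⟨(t.mark d).head, (t.mark d).red.map Dir.swap⟩ := by
  rcases d with ⟨_ | _, _ | _⟩ <;>
  rcases t with ⟨_ | _, _ | _⟩ | ⟨⟨_ | _, _ | _⟩, _ | _ | _, _ | _⟩ <;> decide

theorem isCross_refl {t : Tile} (h : t.IsCross) : t.refl.IsCross := by
  rcases t with ⟨a, b⟩ | ⟨m, r, s⟩
  · trivial
  · exact h.elim

theorem isCross_swap {t : Tile} (h : t.IsCross) : t.swap.IsCross := by
  rcases t with ⟨a, b⟩ | ⟨m, r, s⟩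
  · trivial
  · exact h.elim

end Tile

/-! ### Centre and sides of a supertile. -/

theorem tileAt_center (n : ℕ) (i j : ℤ) :
    tileAt (2 ^ (n + 1) * i + 2 ^ n) (2 ^ (n + 1) * j + 2 ^ n) =
      .cross (decide (i % 2 = 0)) (decide (j % 2 = 0)) := by
  have e : ∀ i : ℤ, 2 ^ (n + 1) * i + 2 ^ n = 2 ^ n * (2 * i + 1) := fun i => by ring
  have hb : ∀ i : ℤ, (!bit (n + 1) (2 ^ (n + 1) * i + 2 ^ n)) = decide (i % 2 = 0) := fun i => by
    unfold bit
    have h0 : (0 : ℤ) < 2 ^ n := by positivity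
    have : (2 ^ (n + 1) * i + 2 ^ n : ℤ) / 2 ^ (n + 1) = i := by
      rw [Int.ediv_eq_iff_of_pos (by positivity), pow_succ]
      constructor <;> nlinarith
    rw [this, ← decide_not, decide_eq_decide]
    omega
  have hv : ∀ i : ℤ, val (2 ^ (n + 1) * i + 2 ^ n) = n := fun i => by
    rw [e]; exact val_mul_odd n _ (by omega)
  rw [tileAt_of_eq (hv i) (hv j), hb, hb]

theorem not_dvd_mul_add {L i a : ℤ} (h1 : 0 < a) (h2 : a < L) : ¬ L ∣ L * i + a := fun h =>
  not_dvd_of_pos_of_lt h1 h2 ((dvd_add_right (dvd_mul_right L i)).1 h)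

theorem tileAt_block_congr {n : ℕ} {i j i' j' a b : ℤ} (hi : i' % 2 = i % 2) (hj : j' % 2 = j % 2)
    (ha : 0 < a) (ha' : a < 2 ^ n) (hb : 0 < b) (hb' : b < 2 ^ n) :
    tileAt (2 ^ n * i' + a) (2 ^ n * j' + b) = tileAt (2 ^ n * i + a) (2 ^ n * j + b) := by
  refine tileAt_congr (not_dvd_mul_add ha ha') (not_dvd_mul_add hb hb') ?_ ?_
  · exact ⟨(i' - i) / 2, by rw [pow_succ, mul_assoc, Int.mul_ediv_cancel' (by omega)]; ring⟩
  · exact ⟨(j' - j) / 2, by rw [pow_succ, mul_assoc, Int.mul_ediv_cancel' (by omega)]; ring⟩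

/-- The drawing on the right side of a supertile. -/
theorem mark_right_block (n : ℕ) (i j b : ℤ) (hb : 0 < b) (hb' : b < 2 ^ (n + 1)) :
    (tileAt (2 ^ (n + 1) * i + (2 ^ (n + 1) - 1)) (2 ^ (n + 1) * j + b)).mark ⟨false, true⟩ =
      ⟨true, if b = 2 ^ n ∧ i % 2 = 0 then some ⟨true, decide (j % 2 = 1)⟩ else none⟩ := by
  have h0 : (0 : ℤ) < 2 ^ n := by positivity
  have hL : (2 : ℤ) ^ (n + 1) = 2 * 2 ^ n := by ring
  -- For `i = -1` the column to the right of the supertile is an axis. Only the parity of `i`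
  -- matters, so `i + 2` can replace it.
  wlog hi : i ≠ -1 generalizing i
  · rw [← tileAt_block_congr (i' := i + 2) (j' := j) (by omega) rfl (by omega) (by omega) hb hb',
      this (i + 2) (by omega)]
    congr 2
    simp
  have hXY : ∀ X : ℤ, X = 2 ^ (n + 1) * (i + 1) → (2 : ℤ) ^ (n + 1) * i + (2 ^ (n + 1) - 1) + 1 = X :=
    fun X hX => by rw [hX]; ring
  set Y : ℤ := 2 ^ (n + 1) * j + b with hY
  have hYd : ¬ (2 : ℤ) ^ (n + 1) ∣ Y := not_dvd_mul_add hb hb'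
  have hY0 := ne_zero_of_not_dvd hYd
  have hYv : val Y < n + 1 := val_lt_of_not_dvd hYd
  have hX0 : (2 : ℤ) ^ (n + 1) * (i + 1) ≠ 0 := mul_ne_zero (by positivity) (by omega)
  have hbit : bit (n + 1) Y = decide (j % 2 = 1) := by
    unfold bit
    have : Y / 2 ^ (n + 1) = j := by
      rw [Int.ediv_eq_iff_of_pos (by positivity), hY]
      constructor <;> nlinarith
    rw [this]
  have hvn : val Y = n ↔ b = 2 ^ n := by
    constructor
    · intro h
      have h1 : (2 : ℤ) ^ n ∣ Y := (pow_dvd_iff_le_val hY0 n).2 h.ge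
      have h2 : (2 : ℤ) ^ n ∣ b := by
        rw [hY, hL] at h1
        exact (dvd_add_right ⟨2 * j, by ring⟩).1 h1
      obtain ⟨c, rfl⟩ := h2
      have hc : c = 1 := by
        have : 0 < c := by nlinarith
        have : c < 2 := by nlinarith
        omega
      rw [hc, mul_one]
    · rintro rfl
      rw [hY, show (2 : ℤ) ^ (n + 1) * j + 2 ^ n = 2 ^ n * (2 * j + 1) by ring]
      exact val_mul_odd n _ (by omega)
  -- The next column has larger valuation than `Y`, so it carries vertical arms. Their side arrows
  -- are red only for consecutive valuations, which means the middle row and even `i`.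
  have hm := tileAt_matches_right (X := 2 ^ (n + 1) * i + (2 ^ (n + 1) - 1))
    (by
      rcases lt_or_gt_of_ne hi with h | h
      · nlinarith
      · nlinarith)
    (by rw [hXY _ rfl]; exact hX0) Y
  rw [hXY _ rfl] at hm
  generalize hm' : (tileAt (2 ^ (n + 1) * i + (2 ^ (n + 1) - 1)) Y).mark ⟨false, true⟩ = mk
  unfold Tile.Matches at hm
  rw [hm'] at hm
  obtain ⟨hd, rd⟩ := mk
  simp only at hm
  obtain ⟨e1, e2⟩ := hm
  have hXle : n + 1 ≤ val (2 ^ (n + 1) * (i + 1)) :=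
    (pow_dvd_iff_le_val hX0 _).1 (dvd_mul_right _ _)
  rw [tileAt_of_gt rfl rfl (show val Y < val (2 ^ (n + 1) * (i + 1)) by omega)] at e1 e2
  simp [Tile.mark, Dir.opp] at e1 e2
  rw [e1, e2]
  congr 1
  rcases Int.emod_two_eq_zero_or_one i with hi2 | hi2
  · rw [val_mul_odd _ _ (by omega)]
    simp [hvn, hi2, hbit]
  · have : n + 2 ≤ val (2 ^ (n + 1) * (i + 1)) := by
      refine (pow_dvd_iff_le_val hX0 _).1 ⟨(i + 1) / 2, ?_⟩
      rw [show n + 2 = n + 1 + 1 from rfl, pow_succ _ (n + 1), mul_assoc,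
        Int.mul_ediv_cancel' (by omega)]
    rw [if_neg (by omega), if_neg (by omega)]

theorem mark_left_block (n : ℕ) (i j b : ℤ) (hb : 0 < b) (hb' : b < 2 ^ (n + 1)) :
    (tileAt (2 ^ (n + 1) * i + 1) (2 ^ (n + 1) * j + b)).mark ⟨false, false⟩ =
      ⟨true, if b = 2 ^ n ∧ i % 2 = 1 then some ⟨true, decide (j % 2 = 1)⟩ else none⟩ := by
  have hX : ¬ (2 : ℤ) ∣ 2 ^ (n + 1) * i + 1 := by
    rw [pow_succ, mul_comm _ (2 : ℤ), mul_assoc]; omega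
  have h := tileAt_refl (ne_zero_of_not_dvd hX) (2 ^ (n + 1) * j + b)
  have e : -((2 : ℤ) ^ (n + 1) * i + 1) = 2 ^ (n + 1) * (-i - 1) + (2 ^ (n + 1) - 1) := by ring
  have h1 := mark_right_block n (-i - 1) j b hb hb'
  rw [← e, h] at h1
  have h2 := Tile.mark_refl (tileAt (2 ^ (n + 1) * i + 1) (2 ^ (n + 1) * j + b)).refl ⟨false, true⟩
  rw [Tile.refl_refl, h1] at h2
  rw [show (⟨false, false⟩ : Dir) = Dir.refl ⟨false, true⟩ from rfl, h2,
    if_congr (show (b = 2 ^ n ∧ (-i - 1) % 2 = 0) ↔ (b = 2 ^ n ∧ i % 2 = 1) by omega) rfl rfl]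
  split_ifs <;> simp [Dir.refl]

/-! ### Supertiles in legal configurations. -/

/-- The matching rule, with crosses on the lattice `(k, l) + 2ℤ²`. -/
structure Legal (X : ℤ → ℤ → Tile) (k l : ℤ) : Prop where
  rule : ∀ a b (d : Dir), (X a b).Matches (X (a + d.vec 0) (b + d.vec 1)) d
  cross : ∀ a b, (a - k) % 2 = 0 → (b - l) % 2 = 0 → (X a b).IsCross

def reflMap (X : ℤ → ℤ → Tile) : ℤ → ℤ → Tile := fun a b => (X (-a) b).refl

def swapMap (X : ℤ → ℤ → Tile) : ℤ → ℤ → Tile := fun a b => (X b a).swap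

theorem reflMap_reflMap (X : ℤ → ℤ → Tile) : reflMap (reflMap X) = X := by
  funext a b; simp [reflMap, Tile.refl_refl]

theorem swapMap_swapMap (X : ℤ → ℤ → Tile) : swapMap (swapMap X) = X := by
  funext a b; simp [swapMap, Tile.swap_swap]

theorem Legal.refl {X : ℤ → ℤ → Tile} {k l : ℤ} (h : Legal X k l) : Legal (reflMap X) (-k) l where
  rule a b d := by
    have := Tile.matches_refl (h.rule (-a) b d.refl)
    rcases d with ⟨_ | _, _ | _⟩ <;>
      simpa [reflMap, Dir.refl, Dir.vec, add_comm] using this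
  cross a b ha hb := Tile.isCross_refl (h.cross _ _ (by omega) hb)

theorem Legal.swap {X : ℤ → ℤ → Tile} {k l : ℤ} (h : Legal X k l) : Legal (swapMap X) l k where
  rule a b d := by
    have := Tile.matches_swap (h.rule b a d.swap)
    rcases d with ⟨_ | _, _ | _⟩ <;>
      simpa [swapMap, Dir.swap, Dir.vec] using this
  cross a b ha hb := Tile.isCross_swap (h.cross _ _ hb ha)

theorem Legal.right {X : ℤ → ℤ → Tile} {k l : ℤ} (h : Legal X k l) (a b : ℤ) :
    (X (a + 1) b).mark ⟨false, false⟩ =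
      ⟨!((X a b).mark ⟨false, true⟩).head, ((X a b).mark ⟨false, true⟩).red⟩ := by
  have := (h.rule a b ⟨false, true⟩)
  simp [Tile.Matches, Dir.vec, Dir.opp] at this
  rw [this.1, this.2]
  simp

theorem Legal.left {X : ℤ → ℤ → Tile} {k l : ℤ} (h : Legal X k l) (a b : ℤ) :
    (X a b).mark ⟨false, true⟩ =
      ⟨!((X (a + 1) b).mark ⟨false, false⟩).head, ((X (a + 1) b).mark ⟨false, false⟩).red⟩ := by
  rw [h.right]
  simp

theorem Legal.up {X : ℤ → ℤ → Tile} {k l : ℤ} (h : Legal X k l) (a b : ℤ) :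
    (X a (b + 1)).mark ⟨true, false⟩ =
      ⟨!((X a b).mark ⟨true, true⟩).head, ((X a b).mark ⟨true, true⟩).red⟩ := by
  have := (h.rule a b ⟨true, true⟩)
  simp [Tile.Matches, Dir.vec, Dir.opp] at this
  rw [this.1, this.2]
  simp

/-- A supertile of side `2 ^ (n + 1) - 1` with corner `(u, v)`, oriented by the parities of `i`
and `j`. -/
structure Block (n : ℕ) (X : ℤ → ℤ → Tile) (k l u v i j : ℤ) : Prop where
  parity : (u - k) % 2 = 1
  parity' : (v - l) % 2 = 1
  agree : ∀ a b : ℤ, 0 < a → a < 2 ^ (n + 1) → 0 < b → b < 2 ^ (n + 1) →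
    X (u + a) (v + b) = tileAt (2 ^ (n + 1) * i + a) (2 ^ (n + 1) * j + b)

namespace Block

variable {n : ℕ} {X : ℤ → ℤ → Tile} {k l u v i j : ℤ}

theorem congr (h : Block n X k l u v i j) {i' j' : ℤ} (hi : i' % 2 = i % 2)
    (hj : j' % 2 = j % 2) : Block n X k l u v i' j' where
  parity := h.parity
  parity' := h.parity'
  agree a b ha ha' hb hb' := by
    rw [h.agree a b ha ha' hb hb', tileAt_block_congr hi hj ha ha' hb hb']

theorem refl (h : Block n X k l u v i j) :
    Block n (reflMap X) (-k) l (-u - 2 ^ (n + 1)) v (-i - 1) j where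
  parity := by
    have := h.parity
    rw [pow_succ]
    omega
  parity' := h.parity'
  agree a b ha ha' hb hb' := by
    have := h.agree (2 ^ (n + 1) - a) b (by omega) (by omega) hb hb'
    have hX : ¬ (2 : ℤ) ^ (n + 1) ∣ 2 ^ (n + 1) * i + (2 ^ (n + 1) - a) :=
      not_dvd_mul_add (by omega) (by omega)
    rw [reflMap, show -(-u - 2 ^ (n + 1) + a) = u + (2 ^ (n + 1) - a) by ring, this,
      ← tileAt_refl (ne_zero_of_not_dvd hX)]
    congr 1
    ring

theorem swap (h : Block n X k l u v i j) : Block n (swapMap X) l k v u j i where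
  parity := h.parity'
  parity' := h.parity
  agree a b ha ha' hb hb' := by
    rw [swapMap, h.agree b a hb hb' ha ha', ← tileAt_swap]

theorem center (h : Block n X k l u v i j) :
    X (u + 2 ^ n) (v + 2 ^ n) = .cross (decide (i % 2 = 0)) (decide (j % 2 = 0)) := by
  have h0 : (0 : ℤ) < 2 ^ n := by positivity
  rw [← tileAt_center n i j]
  exact h.agree _ _ h0 (by rw [pow_succ]; omega) h0 (by rw [pow_succ]; omega)

theorem mark_right (h : Block n X k l u v i j) (hX : Legal X k l) {b : ℤ} (hb : 0 < b)
    (hb' : b < 2 ^ (n + 1)) :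
    (X (u + 2 ^ (n + 1)) (v + b)).mark ⟨false, false⟩ =
      ⟨false, if b = 2 ^ n ∧ i % 2 = 0 then some ⟨true, decide (j % 2 = 1)⟩ else none⟩ := by
  have h1 := hX.right (u + (2 ^ (n + 1) - 1)) (v + b)
  rw [h.agree _ _ (by rw [pow_succ]; omega) (by omega) hb hb', mark_right_block n i j b hb hb'] at h1
  rw [← show u + (2 ^ (n + 1) - 1) + 1 = u + 2 ^ (n + 1) by ring, h1]
  rfl

theorem mark_left (h : Block n X k l u v i j) (hX : Legal X k l) {b : ℤ} (hb : 0 < b)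
    (hb' : b < 2 ^ (n + 1)) :
    (X u (v + b)).mark ⟨false, true⟩ =
      ⟨false, if b = 2 ^ n ∧ i % 2 = 1 then some ⟨true, decide (j % 2 = 1)⟩ else none⟩ := by
  have h1 := hX.left u (v + b)
  have h0 : (0 : ℤ) < 2 ^ n := by positivity
  rw [h.agree 1 _ (by omega) (by rw [pow_succ]; omega) hb hb', mark_left_block n i j b hb hb'] at h1
  rw [h1]
  rfl

theorem mark_up (h : Block n X k l u v i j) (hX : Legal X k l) {a : ℤ} (ha : 0 < a)
    (ha' : a < 2 ^ (n + 1)) :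
    (X (u + a) (v + 2 ^ (n + 1))).mark ⟨true, false⟩ =
      ⟨false, if a = 2 ^ n ∧ j % 2 = 0 then some ⟨false, decide (i % 2 = 1)⟩ else none⟩ := by
  have h1 := h.swap.mark_right hX.swap ha ha'
  have h2 := Tile.mark_swap (swapMap X (v + 2 ^ (n + 1)) (u + a)) ⟨false, false⟩
  rw [h1] at h2
  simp only [swapMap, Tile.swap_swap] at h2
  rw [show (⟨true, false⟩ : Dir) = Dir.swap ⟨false, false⟩ from rfl, h2]
  split_ifs <;> simp [Dir.swap]

theorem mark_down (h : Block n X k l u v i j) (hX : Legal X k l) {a : ℤ} (ha : 0 < a)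
    (ha' : a < 2 ^ (n + 1)) :
    (X (u + a) v).mark ⟨true, true⟩ =
      ⟨false, if a = 2 ^ n ∧ j % 2 = 1 then some ⟨false, decide (i % 2 = 1)⟩ else none⟩ := by
  have h1 := h.swap.mark_left hX.swap ha ha'
  have h2 := Tile.mark_swap (swapMap X v (u + a)) ⟨false, true⟩
  rw [h1] at h2
  simp only [swapMap, Tile.swap_swap] at h2
  rw [show (⟨true, true⟩ : Dir) = Dir.swap ⟨false, true⟩ from rfl, h2]
  split_ifs <;> simp [Dir.swap]

/-- The four quarters of a supertile. -/
theorem quarter (h : Block (n + 1) X k l u v i j) {s t : ℤ} (hs : s = 0 ∨ s = 1)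
    (ht : t = 0 ∨ t = 1) :
    Block n X k l (u + 2 ^ (n + 1) * s) (v + 2 ^ (n + 1) * t) (2 * i + s) (2 * j + t) where
  parity := by
    have := h.parity
    rw [pow_succ, mul_comm _ (2 : ℤ), mul_assoc]
    omega
  parity' := by
    have := h.parity'
    rw [pow_succ, mul_comm _ (2 : ℤ), mul_assoc]
    omega
  agree a b ha ha' hb hb' := by
    have e : (2 : ℤ) ^ (n + 1 + 1) = 2 * 2 ^ (n + 1) := by ring
    have := h.agree (2 ^ (n + 1) * s + a) (2 ^ (n + 1) * t + b)
      (by rcases hs with rfl | rfl <;> omega) (by rcases hs with rfl | rfl <;> omega)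
      (by rcases ht with rfl | rfl <;> omega) (by rcases ht with rfl | rfl <;> omega)
    rw [add_assoc, add_assoc, this, e]
    congr 1 <;> ring

/-- By parity a cross of the first level cannot lie on the middle row or column, so it lies inside a
quarter. -/
theorem exists_quarter (h : Block (n + 1) X k l u v i j) {c d : ℤ} (hc : (c - k) % 2 = 0)
    (hd : (d - l) % 2 = 0) (h1 : u < c) (h2 : c < u + 2 ^ (n + 2)) (h3 : v < d)
    (h4 : d < v + 2 ^ (n + 2)) :
    ∃ s t : ℤ, (s = 0 ∨ s = 1) ∧ (t = 0 ∨ t = 1) ∧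
      Block n X k l (u + 2 ^ (n + 1) * s) (v + 2 ^ (n + 1) * t) (2 * i + s) (2 * j + t) ∧
      u + 2 ^ (n + 1) * s < c ∧ c < u + 2 ^ (n + 1) * s + 2 ^ (n + 1) ∧
      v + 2 ^ (n + 1) * t < d ∧ d < v + 2 ^ (n + 1) * t + 2 ^ (n + 1) := by
  have p1 := h.parity
  have p2 := h.parity'
  have e : (2 : ℤ) ^ (n + 2) = 2 * 2 ^ (n + 1) := by ring
  have e' : (2 : ℤ) ^ (n + 1) = 2 * 2 ^ n := by ring
  rw [e] at h2 h4
  have key : ∀ w c : ℤ, (c - w) % 2 = 1 → w < c → c < w + 2 * 2 ^ (n + 1) →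
      ∃ s : ℤ, (s = 0 ∨ s = 1) ∧ w + 2 ^ (n + 1) * s < c ∧
        c < w + 2 ^ (n + 1) * s + 2 ^ (n + 1) := by
    intro w c hp hw hw'
    by_cases hlt : c < w + 2 ^ (n + 1)
    · exact ⟨0, .inl rfl, by omega, by omega⟩
    · exact ⟨1, .inr rfl, by omega, by omega⟩
  obtain ⟨s, hs, a1, a2⟩ := key u c (by omega) h1 h2
  obtain ⟨t, ht, a3, a4⟩ := key v d (by omega) h3 h4
  exact ⟨s, t, hs, ht, h.quarter hs ht, a1, a2, a3, a4⟩

/-- A cross of the first level lies in at most one supertile of each level. -/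
theorem unique {n : ℕ} {u v i j u' v' i' j' c d : ℤ} (h : Block n X k l u v i j)
    (h' : Block n X k l u' v' i' j') (hc : (c - k) % 2 = 0) (hd : (d - l) % 2 = 0)
    (h1 : u < c) (h2 : c < u + 2 ^ (n + 1)) (h3 : v < d) (h4 : d < v + 2 ^ (n + 1))
    (h1' : u' < c) (h2' : c < u' + 2 ^ (n + 1)) (h3' : v' < d) (h4' : d < v' + 2 ^ (n + 1)) :
    u = u' ∧ v = v' ∧ i % 2 = i' % 2 ∧ j % 2 = j' % 2 := by
  have fin : u = u' → v = v' → u = u' ∧ v = v' ∧ i % 2 = i' % 2 ∧ j % 2 = j' % 2 := by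
    rintro rfl rfl
    have := h.center.symm.trans h'.center
    simp only [Tile.cross.injEq, decide_eq_decide] at this
    exact ⟨rfl, rfl, by omega, by omega⟩
  induction n generalizing u v i j u' v' i' j' with
  | zero =>
    simp only [zero_add, pow_one] at h2 h4 h2' h4'
    exact fin (by omega) (by omega)
  | succ n ih =>
    obtain ⟨s, t, hs, ht, hq, a1, a2, a3, a4⟩ := h.exists_quarter hc hd h1 h2 h3 h4
    obtain ⟨s', t', hs', ht', hq', a1', a2', a3', a4'⟩ := h'.exists_quarter hc hd h1' h2' h3' h4'
    have fin' : u + 2 ^ (n + 1) * s = u' + 2 ^ (n + 1) * s' →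
        v + 2 ^ (n + 1) * t = v' + 2 ^ (n + 1) * t' → _ := fun e1 e2 => by
      have := hq.center.symm.trans ((congrArg₂ X (by rw [e1]) (by rw [e2])).trans hq'.center)
      simp only [Tile.cross.injEq, decide_eq_decide] at this
      exact (⟨e1, e2, by omega, by omega⟩ : _ ∧ _ ∧ (2 * i + s) % 2 = (2 * i' + s') % 2 ∧
        (2 * j + t) % 2 = (2 * j' + t') % 2)
    -- The parity of `2 * i + s` is that of `s`, so the cross lies in the same quarter of both
    -- supertiles.
    obtain ⟨e1, e2, e3, e4⟩ := ih hq hq' a1 a2 a3 a4 a1' a2' a3' a4' fin'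
    have es : s = s' := by omega
    have et : t = t' := by omega
    subst es et
    exact fin (by linarith) (by linarith)

end Block

/-- A legal configuration in which each cross of the first level lies in a supertile of
level `n`. -/
structure Covered (n : ℕ) (X : ℤ → ℤ → Tile) (k l : ℤ) : Prop where
  legal : Legal X k l
  cover : ∀ c d, (c - k) % 2 = 0 → (d - l) % 2 = 0 → ∃ u v i j, Block n X k l u v i j ∧
    u < c ∧ c < u + 2 ^ (n + 1) ∧ v < d ∧ d < v + 2 ^ (n + 1)

namespace Covered

variable {n : ℕ} {X : ℤ → ℤ → Tile} {k l u v i j : ℤ}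

theorem refl (h : Covered n X k l) : Covered n (reflMap X) (-k) l where
  legal := h.legal.refl
  cover c d hc hd := by
    obtain ⟨u, v, i, j, hB, h1, h2, h3, h4⟩ := h.cover (-c) d (by omega) hd
    exact ⟨_, _, _, _, hB.refl, by omega, by omega, h3, h4⟩

theorem swap (h : Covered n X k l) : Covered n (swapMap X) l k where
  legal := h.legal.swap
  cover c d hc hd := by
    obtain ⟨u, v, i, j, hB, h1, h2, h3, h4⟩ := h.cover d c hd hc
    exact ⟨_, _, _, _, hB.swap, h3, h4, h1, h2⟩

end Covered

/-! ### From supertiles of level `n` to level `n + 1`. -/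

namespace Block

variable {n : ℕ} {X : ℤ → ℤ → Tile} {k l u v i j i' j' : ℤ}

theorem of_refl (h : Block n (reflMap X) (-k) l (-u - 2 ^ (n + 1)) v (-i - 1) j) :
    Block n X k l u v i j := by
  have := h.refl
  rw [reflMap_reflMap] at this
  simpa using this

theorem of_swap (h : Block n (swapMap X) l k v u j i) : Block n X k l u v i j := by
  have := h.swap
  rwa [swapMap_swapMap] at this

/-- The red arrow from the middle of the right side meets an arm in the corridor of width one. The
opposite side arrow of this arm must be red with the same displacement, so the neighbour faces back.
-/
theorem facing_of_aligned (hX : Legal X k l) (h : Block n X k l u v i j) (hi : i % 2 = 0)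
    (h' : Block n X k l (u + 2 ^ (n + 1)) v i' j') :
    Block n X k l (u + 2 ^ (n + 1)) v (i + 1) j := by
  have h0 : (0 : ℤ) < 2 ^ n := by positivity
  have hL : (2 : ℤ) ^ n < 2 ^ (n + 1) := by rw [pow_succ]; omega
  have e1 := h.mark_right hX h0 hL
  have e2 := h'.mark_left hX h0 hL
  have := Tile.red_eq_of_tails (congrArg Mark.head e1) (congrArg Mark.head e2)
  rw [e1, e2] at this
  by_cases hi' : i' % 2 = 1
  · simp [hi, hi'] at this
    exact h'.congr (by omega) (by omega)
  · simp [hi, hi'] at this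

/-- A supertile that faces right has a supertile to its right, which is either aligned with it or
displaced by half a period. -/
theorem aligned_or_half (hX : Covered n X k l) (h : Block n X k l u v i j) (hi : i % 2 = 0) :
    Block n X k l (u + 2 ^ (n + 1)) v (i + 1) j ∨
      1 ≤ n ∧ ∃ i' j', Block n X k l (u + 2 ^ (n + 1)) (v + 2 ^ n) i' j' := by
  have p1 := h.parity
  have p2 := h.parity'
  rcases Nat.eq_zero_or_pos n with rfl | hn
  · left
    obtain ⟨u', v', i', j', h', h1, h2, h3, h4⟩ := hX.cover (u + 3) (v + 1) (by omega) (by omega)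
    simp only [zero_add, pow_one] at h2 h4
    obtain rfl : u' = u + 2 := by omega
    obtain rfl : v' = v := by omega
    exact facing_of_aligned hX.legal h hi h'
  · obtain ⟨m, rfl⟩ : ∃ m, n = m + 1 := ⟨n - 1, by omega⟩
    have h0 : (0 : ℤ) < 2 ^ m := by positivity
    have eh : (2 : ℤ) ^ (m + 1) = 2 * 2 ^ m := by ring
    have eL : (2 : ℤ) ^ (m + 1 + 1) = 4 * 2 ^ m := by ring
    -- The cross chosen lies just across the corridor and just above the middle row of the given
    -- supertile.
    obtain ⟨u', v', i', j', h', h1, h2, h3, h4⟩ :=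
      hX.cover (u + 2 ^ (m + 1 + 1) + 1) (v + 2 ^ (m + 1) + 1) (by omega) (by omega)
    have q1 := h'.parity
    have q2 := h'.parity'
    -- Otherwise the new supertile would reach back over the corridor and share a cross of the first
    -- level with the old one.
    have hu : u' = u + 2 ^ (m + 1 + 1) := by
      by_contra hne
      have := (h'.unique h (c := u + 2 ^ (m + 1 + 1) - 1) (d := v + 2 ^ (m + 1) + 1)
        (by omega) (by omega) (by omega) (by omega) h3 h4 (by omega) (by omega) (by omega)
        (by omega)).1
      omega
    subst hu
    by_cases hv : v' = v + 2 ^ (m + 1)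
    · subst hv
      exact .inr ⟨by omega, i', j', h'⟩
    -- The middle row of the first supertile now hits the left side of the second, which can be red
    -- only at its own middle.
    · left
      have e1 := h.mark_right hX.legal (b := 2 ^ (m + 1)) (by omega) (by omega)
      have e2 := h'.mark_left hX.legal (b := v + 2 ^ (m + 1) - v') (by omega) (by omega)
      rw [show v' + (v + 2 ^ (m + 1) - v') = v + 2 ^ (m + 1) by ring] at e2
      have := Tile.red_eq_of_tails (congrArg Mark.head e1) (congrArg Mark.head e2)
      rw [e1, e2] at this
      obtain rfl : v' = v := by
        by_contra hne
        rw [if_pos ⟨rfl, hi⟩, if_neg (by omega)] at this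
        exact absurd this (by simp)
      exact facing_of_aligned hX.legal h hi h'

theorem above_aligned_or_half (hX : Covered n X k l) (h : Block n X k l u v i j) (hj : j % 2 = 0) :
    Block n X k l u (v + 2 ^ (n + 1)) i (j + 1) ∨
      1 ≤ n ∧ ∃ i' j', Block n X k l (u + 2 ^ n) (v + 2 ^ (n + 1)) i' j' := by
  rcases aligned_or_half hX.swap h.swap hj with h | ⟨hn, j', i', h⟩
  · exact .inl h.of_swap
  · exact .inr ⟨hn, i', j', h.of_swap⟩

/-- In the corridor between two supertiles that face each other vertically, the arms point away
from the direction in which the supertiles point. -/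
theorem corridor_head (hX : Legal X k l) (h : Block n X k l u v i j)
    (h' : Block n X k l u (v + 2 ^ (n + 1)) i' j') (hi : i % 2 = 0) (hj : j % 2 = 0) :
    ((X (u + 2 ^ (n + 1)) (v + 2 ^ (n + 1))).mark ⟨false, false⟩).head = true := by
  have h0 : (0 : ℤ) < 2 ^ n := by positivity
  have hL : (2 : ℤ) ^ (n + 1) = 2 ^ n + 2 ^ n := by ring
  have key : ∀ t : ℕ, (t : ℤ) < 2 ^ n →
      ((X (u + (2 ^ n + t)) (v + 2 ^ (n + 1))).mark ⟨false, true⟩).head = false := by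
    intro t
    induction t with
    | zero =>
      intro _
      have e1 := h.mark_up hX (a := 2 ^ n) (by omega) (by omega)
      have e2 := h'.mark_down hX (a := 2 ^ n) (by omega) (by omega)
      rw [if_pos ⟨rfl, hj⟩, show decide (i % 2 = 1) = false by simp [hi]] at e1
      rw [Nat.cast_zero, add_zero]
      exact Tile.left_of_red_left e1 (congrArg Mark.head e2)
    | succ t ih =>
      intro ht
      push_cast at ht ⊢
      have ih := ih (by omega)
      have e1 := h.mark_up hX (a := 2 ^ n + (t + 1)) (by omega) (by omega)
      have e3 := hX.right (u + (2 ^ n + t)) (v + 2 ^ (n + 1))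
      rw [ih, show u + (2 ^ n + (t : ℤ)) + 1 = u + (2 ^ n + (t + 1)) by ring] at e3
      exact Tile.tail_of_head_of_tail _ _ _ (congrArg Mark.head e3) (congrArg Mark.head e1)
        (by decide)
  have := key (2 ^ n - 1) (by push_cast [Nat.one_le_two_pow]; omega)
  have e3 := hX.right (u + (2 ^ n + ((2 ^ n - 1 : ℕ) : ℤ))) (v + 2 ^ (n + 1))
  rw [this] at e3
  push_cast [Nat.one_le_two_pow] at e3
  rw [show u + (2 ^ n + ((2 : ℤ) ^ n - 1)) + 1 = u + 2 ^ (n + 1) by rw [hL]; ring] at e3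
  exact congrArg Mark.head e3

/-- If the supertile above is aligned, the tile where the corridors meet has its head on the left
and, by the displacement, a tail on the right. It is therefore an arm pointing left, which makes the
arms above it in the vertical corridor point down; but the red arrow of the upper supertile demands
one pointing up. If the supertile above is displaced as well, it overlaps the one on the right. -/
theorem not_half (hX : Covered n X k l) (h : Block n X k l u v i j) (hi : i % 2 = 0)
    (hj : j % 2 = 0) (hn : 1 ≤ n)
    (hr : Block n X k l (u + 2 ^ (n + 1)) (v + 2 ^ n) i' j') : False := by
  have p1 := h.parity
  have p2 := h.parity'
  obtain ⟨m, rfl⟩ : ∃ m, n = m + 1 := ⟨n - 1, by omega⟩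
  have h0 : (0 : ℤ) < 2 ^ m := by positivity
  have eh : (2 : ℤ) ^ (m + 1) = 2 * 2 ^ m := by ring
  have eL : (2 : ℤ) ^ (m + 1 + 1) = 4 * 2 ^ m := by ring
  rcases above_aligned_or_half hX h hj with hu | ⟨-, i'', j'', hu⟩
  · have e1 := corridor_head hX.legal h hu hi hj
    have e2 := hr.mark_left hX.legal (b := 2 ^ (m + 1)) (by omega) (by omega)
    rw [show v + 2 ^ (m + 1) + 2 ^ (m + 1) = v + 2 ^ (m + 1 + 1) by rw [eh, eL]; ring] at e2
    have key : ∀ t : ℕ, (t : ℤ) < 2 ^ (m + 1 + 1) →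
        ((X (u + 2 ^ (m + 1 + 1)) (v + 2 ^ (m + 1 + 1) + t)).mark ⟨true, true⟩).head = false := by
      intro t
      induction t with
      | zero =>
        intro _
        rw [Nat.cast_zero, add_zero]
        exact Tile.tail_of_head_of_tail _ _ _ e1 (congrArg Mark.head e2) (by decide)
      | succ t ih =>
        intro ht
        push_cast at ht ⊢
        have ih := ih (by omega)
        have e3 := hX.legal.up (u + 2 ^ (m + 1 + 1)) (v + 2 ^ (m + 1 + 1) + t)
        have e4 := hu.mark_right hX.legal (b := t + 1) (by omega) (by omega)
        rw [ih, add_assoc _ (t : ℤ)] at e3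
        exact Tile.tail_of_head_of_tail _ _ _ (congrArg Mark.head e3) (congrArg Mark.head e4)
          (by decide)
    have e5 := key (2 ^ (m + 1) - 1) (by push_cast [Nat.one_le_two_pow]; omega)
    have e3 := hX.legal.up (u + 2 ^ (m + 1 + 1))
      (v + 2 ^ (m + 1 + 1) + ((2 ^ (m + 1) - 1 : ℕ) : ℤ))
    rw [e5] at e3
    push_cast [Nat.one_le_two_pow] at e3
    rw [show v + 2 ^ (m + 1 + 1) + ((2 : ℤ) ^ (m + 1) - 1) + 1 =
      v + 2 ^ (m + 1 + 1) + 2 ^ (m + 1) by ring] at e3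
    have e4 := hu.mark_right hX.legal (b := 2 ^ (m + 1)) (by omega) (by omega)
    rw [if_pos ⟨rfl, hi⟩, show decide ((j + 1) % 2 = 1) = true by simp; omega] at e4
    exact Tile.not_down_of_red_up e4 (congrArg Mark.head e3)
  · have := (hu.unique hr (c := u + 2 ^ (m + 1 + 1) + 1) (d := v + 2 ^ (m + 1 + 1) + 1)
      (by omega) (by omega) (by omega) (by omega) (by omega) (by omega) (by omega) (by omega)
      (by omega) (by omega)).1
    omega

theorem facing_right (hX : Covered n X k l) (h : Block n X k l u v i j) (hi : i % 2 = 0) :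
    Block n X k l (u + 2 ^ (n + 1)) v (i + 1) j := by
  have even : ∀ {X : ℤ → ℤ → Tile} {k l u v i j : ℤ}, Covered n X k l → Block n X k l u v i j →
      i % 2 = 0 → j % 2 = 0 → Block n X k l (u + 2 ^ (n + 1)) v (i + 1) j := by
    intro X k l u v i j hX h hi hj
    rcases aligned_or_half hX h hi with h' | ⟨hn, i', j', h'⟩
    · exact h'
    · exact (not_half hX h hi hj hn h').elim
  rcases Int.emod_two_eq_zero_or_one j with hj | hj
  · exact even hX h hi hj
  -- Conjugating the reflection by the swap reverses the vertical coordinate and makes `j` even.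
  · have := even hX.swap.refl.swap h.swap.refl.swap hi (by omega)
    exact this.of_swap.of_refl.of_swap

theorem facing_left (hX : Covered n X k l) (h : Block n X k l u v i j) (hi : i % 2 = 1) :
    Block n X k l (u - 2 ^ (n + 1)) v (i - 1) j := by
  have := facing_right hX.refl h.refl (by omega)
  apply of_refl
  convert this using 1 <;> ring

/-- Each supertile lies in a square of four supertiles that face one another. -/
theorem exists_even (hX : Covered n X k l) (h : Block n X k l u v i j) :
    ∃ u₀ v₀ i₀ j₀, Block n X k l u₀ v₀ i₀ j₀ ∧ i₀ % 2 = 0 ∧ j₀ % 2 = 0 ∧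
      u₀ ≤ u ∧ u ≤ u₀ + 2 ^ (n + 1) ∧ v₀ ≤ v ∧ v ≤ v₀ + 2 ^ (n + 1) := by
  have h0 : (0 : ℤ) < 2 ^ (n + 1) := by positivity
  have hor : ∀ {X : ℤ → ℤ → Tile} {k l u v i j : ℤ}, Covered n X k l → Block n X k l u v i j →
      ∃ u₀ i₀, Block n X k l u₀ v i₀ j ∧ i₀ % 2 = 0 ∧ u₀ ≤ u ∧ u ≤ u₀ + 2 ^ (n + 1) := by
    intro X k l u v i j hX h
    rcases Int.emod_two_eq_zero_or_one i with hi | hi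
    · exact ⟨u, i, h, hi, le_rfl, by omega⟩
    · exact ⟨_, _, facing_left hX h hi, by omega, by omega, by omega⟩
  obtain ⟨u₀, i₀, h1, h2, h3, h4⟩ := hor hX h
  obtain ⟨v₀, j₀, h5, h6, h7, h8⟩ := hor hX.swap h1.swap
  exact ⟨u₀, v₀, i₀, j₀, h5.of_swap, h2, h6, h3, h4, h7, h8⟩

/-- Four supertiles that face one another form a supertile of the next level. -/
theorem exists_next (hX : Covered n X k l) (h : Block n X k l u v i j) (hi : i % 2 = 0)
    (hj : j % 2 = 0) : ∃ I J, Block (n + 1) X k l u v I J := by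
  have hL : (0 : ℤ) < 2 ^ (n + 1) := by positivity
  have eL : (2 : ℤ) ^ (n + 1 + 1) = 2 * 2 ^ (n + 1) := by ring
  have hr := facing_right hX h hi
  have hu : Block n X k l u (v + 2 ^ (n + 1)) i (j + 1) := (facing_right hX.swap h.swap hj).of_swap
  have hru := facing_right hX hu hi
  -- The corridors on both sides give this tile a head on its left and on its right; only a cross
  -- has two heads.
  obtain ⟨a, b, hab⟩ : ∃ a b, X (u + 2 ^ (n + 1)) (v + 2 ^ (n + 1)) = .cross a b := by
    apply Tile.isCross_of_heads
    · exact corridor_head hX.legal h hu hi hj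
    · have h1 := corridor_head hX.refl.legal hr.refl hru.refl (by omega) hj
      have h2 := Tile.mark_refl (reflMap X (-(u + 2 ^ (n + 1)) - 2 ^ (n + 1) + 2 ^ (n + 1))
        (v + 2 ^ (n + 1))) ⟨false, false⟩
      have h3 := congrArg Mark.head h2
      rw [h1] at h3
      simpa [reflMap, Tile.refl_refl, Dir.refl, add_comm] using h3
  -- Nonnegative representatives keep the coordinates in `D` positive, where `tileAt_matches`
  -- applies.
  let I : ℤ := if a then 0 else 1
  let J : ℤ := if b then 0 else 1
  have hI : 0 ≤ I := by simp only [I]; split_ifs <;> norm_num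
  have hJ : 0 ≤ J := by simp only [J]; split_ifs <;> norm_num
  let D : ℤ → ℤ → Tile := fun a b => tileAt (2 ^ (n + 1 + 1) * I + a) (2 ^ (n + 1 + 1) * J + b)
  have quart : ∀ s t : ℤ, ∀ i' j', Block n X k l (u + 2 ^ (n + 1) * s) (v + 2 ^ (n + 1) * t) i' j' →
      i' % 2 = (2 * I + s) % 2 → j' % 2 = (2 * J + t) % 2 → ∀ a b : ℤ, 0 < a → a < 2 ^ (n + 1) →
      0 < b → b < 2 ^ (n + 1) → X (u + (2 ^ (n + 1) * s + a)) (v + (2 ^ (n + 1) * t + b)) =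
        D (2 ^ (n + 1) * s + a) (2 ^ (n + 1) * t + b) := by
    intro s t i' j' hB hi' hj' a b ha ha' hb hb'
    rw [← add_assoc, ← add_assoc, (hB.congr hi'.symm hj'.symm).agree a b ha ha' hb hb']
    simp only [D, eL]
    congr 1 <;> ring
  have q00 := quart 0 0 i j (by simpa using h) (by omega) (by omega)
  have q10 := quart 1 0 (i + 1) j (by simpa using hr) (by omega) (by omega)
  have q01 := quart 0 1 i (j + 1) (by simpa using hu) (by omega) (by omega)
  have q11 := quart 1 1 (i + 1) (j + 1) (by simpa using hru) (by omega) (by omega)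
  clear quart
  have off : ∀ a b : ℤ, 0 < a → a < 2 * 2 ^ (n + 1) → 0 < b → b < 2 * 2 ^ (n + 1) →
      a ≠ 2 ^ (n + 1) → b ≠ 2 ^ (n + 1) → X (u + a) (v + b) = D a b := by
    intro a b ha ha' hb hb' hane hbne
    rcases lt_or_gt_of_ne hane with h1 | h1 <;> rcases lt_or_gt_of_ne hbne with h2 | h2
    · simpa using q00 a b (by omega) (by omega) (by omega) (by omega)
    · simpa using q01 a (b - 2 ^ (n + 1)) (by omega) (by omega) (by omega) (by omega)
    · simpa using q10 (a - 2 ^ (n + 1)) b (by omega) (by omega) (by omega) (by omega)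
    · simpa using q11 (a - 2 ^ (n + 1)) (b - 2 ^ (n + 1)) (by omega) (by omega) (by omega) (by omega)
  have mid : X (u + 2 ^ (n + 1)) (v + 2 ^ (n + 1)) = D (2 ^ (n + 1)) (2 ^ (n + 1)) := by
    have := tileAt_center (n + 1) I J
    simp only [D]
    rw [this, hab]
    simp only [I, J]
    cases a <;> cases b <;> simp
  -- Three known neighbours determine a tile, so the four arms get filled in one tile at a time,
  -- outwards from the central cross.
  have fill : ∀ (e : Dir) (a b : ℤ), 0 < a → a < 2 * 2 ^ (n + 1) → 0 < b → b < 2 * 2 ^ (n + 1) →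
      (∀ d ≠ e, 0 < a + d.vec 0 ∧ 0 < b + d.vec 1 ∧
        X (u + (a + d.vec 0)) (v + (b + d.vec 1)) = D (a + d.vec 0) (b + d.vec 1)) →
      X (u + a) (v + b) = D a b := by
    intro e a b ha ha' hb hb' hd
    have hI' : 0 ≤ (2 : ℤ) ^ (n + 1 + 1) * I := by positivity
    have hJ' : 0 ≤ (2 : ℤ) ^ (n + 1 + 1) * J := by positivity
    refine Tile.eq_of_matches e (nb := fun d => D (a + d.vec 0) (b + d.vec 1)) ?_ ?_
    · intro d hde
      have := hX.legal.rule (u + a) (v + b) d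
      rwa [add_assoc u, add_assoc v, (hd d hde).2.2] at this
    · intro d hde
      have h1 := hd d hde
      have := tileAt_matches (X := 2 ^ (n + 1 + 1) * I + a) (Y := 2 ^ (n + 1 + 1) * J + b) d
        (by omega) (by omega) (by omega) (by omega)
      simpa only [D, add_assoc] using this
  have vec0 : Dir.vec ⟨false, false⟩ 0 = -1 := rfl
  have vec1 : Dir.vec ⟨false, false⟩ 1 = 0 := rfl
  have vec2 : Dir.vec ⟨false, true⟩ 0 = 1 := rfl
  have vec3 : Dir.vec ⟨false, true⟩ 1 = 0 := rfl
  have vec4 : Dir.vec ⟨true, false⟩ 0 = 0 := rfl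
  have vec5 : Dir.vec ⟨true, false⟩ 1 = -1 := rfl
  have vec6 : Dir.vec ⟨true, true⟩ 0 = 0 := rfl
  have vec7 : Dir.vec ⟨true, true⟩ 1 = 1 := rfl
  have up : ∀ t : ℕ, (t : ℤ) < 2 ^ (n + 1) →
      X (u + 2 ^ (n + 1)) (v + (2 ^ (n + 1) + t)) = D (2 ^ (n + 1)) (2 ^ (n + 1) + t) := by
    intro t
    induction t with
    | zero => intro _; simpa using mid
    | succ t ih =>
      intro ht
      push_cast at ht ⊢
      refine fill ⟨true, true⟩ _ _ (by omega) (by omega) (by omega) (by omega) fun d hd => ?_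
      rcases d with ⟨_ | _, _ | _⟩ <;> simp only [vec0, vec1, vec2, vec3, vec4, vec5, vec6, vec7]
      · exact ⟨by omega, by omega, off _ _ (by omega) (by omega) (by omega) (by omega)
          (by omega) (by omega)⟩
      · exact ⟨by omega, by omega, off _ _ (by omega) (by omega) (by omega) (by omega)
          (by omega) (by omega)⟩
      · refine ⟨by omega, by omega, ?_⟩
        rw [add_zero, show (2 : ℤ) ^ (n + 1) + (t + 1) + -1 = 2 ^ (n + 1) + t by ring]
        exact ih (by omega)
      · exact absurd rfl hd
  have down : ∀ t : ℕ, (t : ℤ) < 2 ^ (n + 1) →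
      X (u + 2 ^ (n + 1)) (v + (2 ^ (n + 1) - t)) = D (2 ^ (n + 1)) (2 ^ (n + 1) - t) := by
    intro t
    induction t with
    | zero => intro _; simpa using mid
    | succ t ih =>
      intro ht
      push_cast at ht ⊢
      refine fill ⟨true, false⟩ _ _ (by omega) (by omega) (by omega) (by omega) fun d hd => ?_
      rcases d with ⟨_ | _, _ | _⟩ <;> simp only [vec0, vec1, vec2, vec3, vec4, vec5, vec6, vec7]
      · exact ⟨by omega, by omega, off _ _ (by omega) (by omega) (by omega) (by omega)
          (by omega) (by omega)⟩
      · exact ⟨by omega, by omega, off _ _ (by omega) (by omega) (by omega) (by omega)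
          (by omega) (by omega)⟩
      · exact absurd rfl hd
      · refine ⟨by omega, by omega, ?_⟩
        rw [add_zero, show (2 : ℤ) ^ (n + 1) - (t + 1) + 1 = 2 ^ (n + 1) - t by ring]
        exact ih (by omega)
  have right : ∀ t : ℕ, (t : ℤ) < 2 ^ (n + 1) →
      X (u + (2 ^ (n + 1) + t)) (v + 2 ^ (n + 1)) = D (2 ^ (n + 1) + t) (2 ^ (n + 1)) := by
    intro t
    induction t with
    | zero => intro _; simpa using mid
    | succ t ih =>
      intro ht
      push_cast at ht ⊢
      refine fill ⟨false, true⟩ _ _ (by omega) (by omega) (by omega) (by omega) fun d hd => ?_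
      rcases d with ⟨_ | _, _ | _⟩ <;> simp only [vec0, vec1, vec2, vec3, vec4, vec5, vec6, vec7]
      · refine ⟨by omega, by omega, ?_⟩
        rw [add_zero, show (2 : ℤ) ^ (n + 1) + (t + 1) + -1 = 2 ^ (n + 1) + t by ring]
        exact ih (by omega)
      · exact absurd rfl hd
      · exact ⟨by omega, by omega, off _ _ (by omega) (by omega) (by omega) (by omega)
          (by omega) (by omega)⟩
      · exact ⟨by omega, by omega, off _ _ (by omega) (by omega) (by omega) (by omega)
          (by omega) (by omega)⟩
  have left : ∀ t : ℕ, (t : ℤ) < 2 ^ (n + 1) →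
      X (u + (2 ^ (n + 1) - t)) (v + 2 ^ (n + 1)) = D (2 ^ (n + 1) - t) (2 ^ (n + 1)) := by
    intro t
    induction t with
    | zero => intro _; simpa using mid
    | succ t ih =>
      intro ht
      push_cast at ht ⊢
      refine fill ⟨false, false⟩ _ _ (by omega) (by omega) (by omega) (by omega) fun d hd => ?_
      rcases d with ⟨_ | _, _ | _⟩ <;> simp only [vec0, vec1, vec2, vec3, vec4, vec5, vec6, vec7]
      · exact absurd rfl hd
      · refine ⟨by omega, by omega, ?_⟩
        rw [add_zero, show (2 : ℤ) ^ (n + 1) - (t + 1) + 1 = 2 ^ (n + 1) - t by ring]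
        exact ih (by omega)
      · exact ⟨by omega, by omega, off _ _ (by omega) (by omega) (by omega) (by omega)
          (by omega) (by omega)⟩
      · exact ⟨by omega, by omega, off _ _ (by omega) (by omega) (by omega) (by omega)
          (by omega) (by omega)⟩
  refine ⟨I, J, h.parity, h.parity', fun a b ha ha' hb hb' => ?_⟩
  rw [eL] at ha' hb'
  by_cases ea : a = 2 ^ (n + 1)
  · subst ea
    rcases le_total (2 ^ (n + 1)) b with hle | hle
    · obtain ⟨t, ht⟩ := Int.eq_ofNat_of_zero_le (sub_nonneg.2 hle)
      obtain rfl : b = 2 ^ (n + 1) + t := by omega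
      exact up t (by omega)
    · obtain ⟨t, ht⟩ := Int.eq_ofNat_of_zero_le (sub_nonneg.2 hle)
      obtain rfl : b = 2 ^ (n + 1) - t := by omega
      exact down t (by omega)
  · by_cases eb : b = 2 ^ (n + 1)
    · subst eb
      rcases le_total (2 ^ (n + 1)) a with hle | hle
      · obtain ⟨t, ht⟩ := Int.eq_ofNat_of_zero_le (sub_nonneg.2 hle)
        obtain rfl : a = 2 ^ (n + 1) + t := by omega
        exact right t (by omega)
      · obtain ⟨t, ht⟩ := Int.eq_ofNat_of_zero_le (sub_nonneg.2 hle)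
        obtain rfl : a = 2 ^ (n + 1) - t := by omega
        exact left t (by omega)
    · exact off a b ha ha' hb hb' ea eb

end Block

theorem Legal.covered {X : ℤ → ℤ → Tile} {k l : ℤ} (hX : Legal X k l) (n : ℕ) :
    Covered n X k l := by
  refine ⟨hX, ?_⟩
  induction n with
  | zero =>
    intro c d hc hd
    have hcr := hX.cross c d hc hd
    rcases hxt : X c d with ⟨a, b⟩ | ⟨m, r, s⟩
    · refine ⟨c - 1, d - 1, if a then 0 else 1, if b then 0 else 1, ⟨by omega, by omega, ?_⟩,
        by omega, by rw [zero_add, pow_one]; omega, by omega, by rw [zero_add, pow_one]; omega⟩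
      intro s t h1 h2 h3 h4
      simp only [zero_add, pow_one] at h2 h4
      obtain rfl : s = 1 := by omega
      obtain rfl : t = 1 := by omega
      have := tileAt_center 0 (if a then 0 else 1) (if b then 0 else 1)
      rw [pow_zero] at this
      rw [this]
      simp only [sub_add_cancel, hxt]
      cases a <;> cases b <;> simp
    · rw [hxt] at hcr
      exact hcr.elim
  | succ n ih =>
    intro c d hc hd
    obtain ⟨u, v, i, j, hB, h1, h2, h3, h4⟩ := ih c d hc hd
    obtain ⟨u₀, v₀, i₀, j₀, hB', hi, hj, a1, a2, a3, a4⟩ := hB.exists_even ⟨hX, ih⟩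
    obtain ⟨I, J, hN⟩ := hB'.exists_next ⟨hX, ih⟩ hi hj
    have e : (2 : ℤ) ^ (n + 1 + 1) = 2 * 2 ^ (n + 1) := by ring
    exact ⟨u₀, v₀, I, J, hN, by omega, by omega, by omega, by omega⟩

theorem rob_subset_closure_of_mem_robinsonShift {x : Config Tile 2} (hx : x ∈ robinsonShift) :
    rob.carrier ⊆ closure (Set.range fun v : Lattice 2 => shift v x) := by
  obtain ⟨hrule, k, hk, -⟩ := hx
  have hL : Legal (fun a b => x ![a, b]) (k 0) (k 1) := by
    constructor
    · intro a b d
      have := hrule ![a, b] d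
      convert this using 2
      ext i
      fin_cases i <;> simp
    · intro a b ha hb
      convert hk ![(a - k 0) / 2, (b - k 1) / 2]
      ext i
      fin_cases i <;> simp <;> omega
  apply rob_subset_closure
  intro n
  obtain ⟨u, v, i, j, hB, -⟩ := (hL.covered (n + 1)).cover (k 0) (k 1) (by simp) (by simp)
  refine ⟨![u, v], fun p hp => ?_⟩
  have e : (2 : ℤ) ^ (n + 1 + 1) = 4 * 2 ^ n := by ring
  have h0 := hp 0
  have h1 := hp 1
  have := hB.agree (p 0) (p 1) h0.1 (by omega) h1.1 (by omega)
  have e2 : ![u, v] + p = ![u + p 0, v + p 1] := by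
    ext i
    fin_cases i <;> simp
  rw [e2, this]
  refine tileAt_congr (K := n) (not_dvd_of_pos_of_lt h0.1 h0.2) (not_dvd_of_pos_of_lt h1.1 h1.2)
    ⟨2 * i, ?_⟩ ⟨2 * j, ?_⟩ <;> ring

/-! ### Points with a singular row, and minimality -/

/-- The limit of supertiles with an infinite horizontal arm in the row `0`, which points to the
right if `e` holds and to the left otherwise. -/
def rowPoint (e : Bool) : Config Tile 2 := fun p =>
  if p 1 = 0 then .arm ⟨false, e⟩ none false
  else if p 0 = 0 then .arm ⟨true, decide (p 1 < 0)⟩ none false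
  else hier p

theorem rowPoint_mem (e : Bool) : rowPoint e ∈ rob.carrier := by
  intro N
  -- Both binary digits of `E` equal `e`: the first gives the direction of the row, and their
  -- equality excludes red.
  obtain ⟨E, hE⟩ : ∃ E : ℤ, E = if e then 3 else 0 := ⟨_, rfl⟩
  have hE0 : 0 ≤ E := by rw [hE]; split_ifs <;> norm_num
  have hN : (N : ℤ) < 2 ^ N := by exact_mod_cast Nat.lt_two_pow_self
  generalize hT : (2 : ℤ) ^ N = T at hN
  have hT0 : 0 < T := by rw [← hT]; positivity
  have e1 : (2 : ℤ) ^ (N + 1) = 2 * T := by rw [← hT]; ring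
  have e2 : (2 : ℤ) ^ (N + 2) = 4 * T := by rw [← hT]; ring
  have e3 : (2 : ℤ) ^ (N + 3) = 8 * T := by rw [← hT]; ring
  have e4 : (2 : ℤ) ^ (2 * (N + 2)) = 4 * T * (4 * T) := by rw [← hT]; ring
  have e5 : (2 : ℤ) ^ (2 * (N + 2) + 1) = 2 * (4 * T * (4 * T)) := by rw [← hT]; ring
  have hTT : 4 * T * (4 * T) ≥ 16 * T := by nlinarith
  -- The column has valuation `N + 2` and the row the much larger `2 * (N + 2)`. Digits `N + 2` and
  -- `N + 3` of the second coordinate are both 1 just below the row and both 0 just above, so the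
  -- column points to the row without red.
  refine ⟨![4 * T + E * (4 * T * (4 * T)), 4 * T * (4 * T)], fun p hp => ?_⟩
  have h0 := abs_le.1 (hp 0)
  have h1 := abs_le.1 (hp 1)
  have hE1 : 0 ≤ E * (4 * T * (4 * T)) := by positivity
  refine ⟨fun i => ?_, ?_⟩
  · fin_cases i
    · simp; omega
    · simp; omega
  have ndvd : ∀ a : ℤ, a ≠ 0 → -N ≤ a → a ≤ N → ¬ (2 : ℤ) ^ (N + 1) ∣ a := by
    intro a ha h h' hd
    have := Int.le_of_dvd (abs_pos.2 ha) ((dvd_abs _ _).2 hd)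
    have := abs_le.2 ⟨h, h'⟩
    omega
  by_cases hp1 : p 1 = 0
  · have hY : val (4 * T * (4 * T) + p 1) = 2 * (N + 2) := by
      rw [hp1, add_zero, ← e4]
      simpa using val_mul_odd (2 * (N + 2)) 1 rfl
    have hX : val (4 * T + E * (4 * T * (4 * T)) + p 0) < N + 3 := by
      apply val_lt_of_not_dvd
      rw [e3, show 4 * T + E * (4 * T * (4 * T)) + p 0 = 8 * T * (E * T * 2) + (4 * T + p 0) by ring]
      exact not_dvd_mul_add (by omega) (by omega)
    have b1 : bit (2 * (N + 2)) (4 * T + E * (4 * T * (4 * T)) + p 0) = e := by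
      unfold bit
      have : (4 * T + E * (4 * T * (4 * T)) + p 0) / 2 ^ (2 * (N + 2)) = E := by
        rw [Int.ediv_eq_iff_of_pos (by positivity), e4]
        constructor
        · linarith
        · linarith
      rw [this, hE]
      cases e <;> simp
    have b2 : bit (2 * (N + 2) + 1) (4 * T + E * (4 * T * (4 * T)) + p 0) = e := by
      unfold bit
      have : (4 * T + E * (4 * T * (4 * T)) + p 0) / 2 ^ (2 * (N + 2) + 1) =
          if e then 1 else 0 := by
        rw [Int.ediv_eq_iff_of_pos (by positivity), e5, hE]
        cases e
        · simp; constructor <;> omega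
        · simp; constructor <;> omega
      rw [this]
      cases e <;> simp
    simp only [rowPoint, hp1, if_true, hier, Pi.add_apply, cons_val_zero, cons_val_one]
    rw [hp1] at hY
    rw [tileAt_of_lt rfl hY (by omega), b1, b2]
    simp
    omega
  · by_cases hp0 : p 0 = 0
    · have hX : val (4 * T + E * (4 * T * (4 * T)) + p 0) = N + 2 := by
        rw [hp0, show 4 * T + E * (4 * T * (4 * T)) + 0 = 2 ^ (N + 2) * (2 * (2 * E * T) + 1) by
          rw [e2]; ring]
        exact val_mul_odd _ _ (by omega)
      have hY : val (4 * T * (4 * T) + p 1) < N + 1 := by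
        apply val_lt_of_not_dvd
        intro hd
        exact ndvd (p 1) hp1 h1.1 h1.2 ((dvd_add_right ⟨8 * T, by rw [e1]; ring⟩).1 hd)
      have b1 : bit (N + 2) (4 * T * (4 * T) + p 1) = decide (p 1 < 0) := by
        unfold bit
        rcases lt_or_gt_of_ne hp1 with h | h
        · have : (4 * T * (4 * T) + p 1) / 2 ^ (N + 2) = 4 * T - 1 := by
            rw [Int.ediv_eq_iff_of_pos (by positivity), e2]
            constructor <;> linarith
          rw [this, decide_eq_decide]
          omega
        · have : (4 * T * (4 * T) + p 1) / 2 ^ (N + 2) = 4 * T := by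
            rw [Int.ediv_eq_iff_of_pos (by positivity), e2]
            constructor <;> linarith
          rw [this, decide_eq_decide]
          omega
      have b2 : bit (N + 2 + 1) (4 * T * (4 * T) + p 1) = decide (p 1 < 0) := by
        unfold bit
        rcases lt_or_gt_of_ne hp1 with h | h
        · have : (4 * T * (4 * T) + p 1) / 2 ^ (N + 2 + 1) = 2 * T - 1 := by
            rw [Int.ediv_eq_iff_of_pos (by positivity), e3]
            constructor <;> linarith
          rw [this, decide_eq_decide]
          omega
        · have : (4 * T * (4 * T) + p 1) / 2 ^ (N + 2 + 1) = 2 * T := by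
            rw [Int.ediv_eq_iff_of_pos (by positivity), e3]
            constructor <;> linarith
          rw [this, decide_eq_decide]
          omega
      simp only [rowPoint, hp1, hp0, if_true, if_false, hier, Pi.add_apply, cons_val_zero,
        cons_val_one]
      rw [hp0] at hX
      rw [tileAt_of_gt hX rfl (by omega), b1, b2]
      simp
      omega
    · simp only [rowPoint, hp1, hp0, if_false]
      refine (hier_congr (K := N + 1) (fun i => ?_) fun i => ?_).symm
      · fin_cases i
        · exact ndvd _ hp0 h0.1 h0.2
        · exact ndvd _ hp1 h1.1 h1.2
      · rw [show N + 1 + 1 = N + 2 from rfl, e2]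
        fin_cases i
        · exact ⟨1 + E * (4 * T), by simp; ring⟩
        · exact ⟨4 * T, by simp⟩

theorem rob_isMinimal : rob.IsMinimal :=
  ⟨⟨_, rowPoint_mem true⟩, fun _ hx => rob_subset_closure_of_mem hx⟩

theorem Subshift.closure_orbit_subset (X : Subshift Tile 2) {x : Config Tile 2}
    (hx : x ∈ X.carrier) :
    closure (Set.range fun v : Lattice 2 => shift v x) ⊆ X.carrier :=
  X.isClosed.closure_subset_iff.2 (Set.range_subset_iff.2 fun v => X.shift_mem v x hx)

theorem eq_rob_of_isMinimal {M : Subshift Tile 2} (hM : M.IsMinimal)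
    (hsub : M.carrier ⊆ robinsonShift) : M = rob := by
  obtain ⟨x, hx⟩ := hM.1
  have h1 : rob.carrier ⊆ M.carrier :=
    (rob_subset_closure_of_mem_robinsonShift (hsub hx)).trans (M.closure_orbit_subset hx)
  have hy := rowPoint_mem true
  have h2 : M.carrier ⊆ rob.carrier :=
    (hM.2 _ (h1 hy)).trans (rob.closure_orbit_subset hy)
  cases M
  cases hr : rob
  rw [hr] at h1 h2
  congr
  exact h2.antisymm h1

/-! ### Reflections -/

def reflConfig (x : Config Tile 2) : Config Tile 2 := fun p => (x ![-p 0, p 1]).refl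

def swapConfig (x : Config Tile 2) : Config Tile 2 := fun p => (x ![p 1, p 0]).swap

theorem reflConfig_reflConfig (x : Config Tile 2) : reflConfig (reflConfig x) = x := by
  funext p
  simp only [reflConfig, Tile.refl_refl]
  congr
  ext i
  fin_cases i <;> simp

theorem swapConfig_swapConfig (x : Config Tile 2) : swapConfig (swapConfig x) = x := by
  funext p
  simp only [swapConfig, Tile.swap_swap]
  congr
  ext i
  fin_cases i <;> simp

theorem hier_refl {q : Lattice 2} (h : q 0 ≠ 0) : hier ![-q 0, q 1] = (hier q).refl :=
  tileAt_refl h (q 1)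

theorem hier_swap (q : Lattice 2) : hier ![q 1, q 0] = (hier q).swap :=
  tileAt_swap (q 0) (q 1)

theorem reflConfig_mem {x : Config Tile 2} (hx : x ∈ rob.carrier) : reflConfig x ∈ rob.carrier := by
  intro N
  obtain ⟨u, hu⟩ := hx N
  refine ⟨![-u 0, u 1], fun p hp => ?_⟩
  have h := hu ![-p 0, p 1] fun i => by
    have := hp i
    fin_cases i <;> simpa using this
  have e : ![-u 0, u 1] + p = ![-(u + ![-p 0, p 1]) 0, (u + ![-p 0, p 1]) 1] := by
    ext i
    fin_cases i <;> simp
    ring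
  rw [e]
  refine ⟨fun i => ?_, ?_⟩
  · have h0 := h.1 0
    have h1 := h.1 1
    fin_cases i
    · exact neg_ne_zero.2 h0
    · exact h1
  · rw [hier_refl (h.1 0), ← h.2]
    rfl

theorem swapConfig_mem {x : Config Tile 2} (hx : x ∈ rob.carrier) : swapConfig x ∈ rob.carrier := by
  intro N
  obtain ⟨u, hu⟩ := hx N
  refine ⟨![u 1, u 0], fun p hp => ?_⟩
  have h := hu ![p 1, p 0] fun i => by
    have h0 := hp 0
    have h1 := hp 1
    fin_cases i
    · exact h1
    · exact h0
  have e : ![u 1, u 0] + p = ![(u + ![p 1, p 0]) 1, (u + ![p 1, p 0]) 0] := by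
    ext i
    fin_cases i <;> simp
  rw [e]
  refine ⟨fun i => ?_, ?_⟩
  · have h0 := h.1 0
    have h1 := h.1 1
    fin_cases i
    · exact h1
    · exact h0
  · rw [hier_swap, ← h.2]
    rfl

/-! ### Singular lines -/

/-- The line of lattice points with `i`-th coordinate `c` lies in no finite level of the
hierarchy of `x`. -/
def Sing (i : Fin 2) (x : Config Tile 2) (c : ℤ) : Prop :=
  ∀ n u, Approx n x u → (2 : ℤ) ^ (n + 2) ∣ u i + c

theorem eq_of_forall_pow_dvd {a b : ℤ} (h : ∀ n : ℕ, (2 : ℤ) ^ n ∣ a - b) : a = b := by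
  have hlt : ((a - b).natAbs : ℤ) < 2 ^ (a - b).natAbs := by exact_mod_cast Nat.lt_two_pow_self
  have := Int.eq_zero_of_abs_lt_dvd (h (a - b).natAbs) (by rwa [← Int.natCast_natAbs])
  omega

theorem Sing.unique {i : Fin 2} {x : Config Tile 2} (hx : x ∈ rob.carrier) {c c' : ℤ}
    (h : Sing i x c) (h' : Sing i x c') : c = c' := by
  refine eq_of_forall_pow_dvd fun n => ?_
  obtain ⟨u, hu⟩ := exists_approx hx n
  have := dvd_sub (h n u hu) (h' n u hu)
  rw [add_sub_add_left_eq_sub] at this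
  exact (pow_dvd_pow 2 (by omega)).trans this

/-- Two points at the same position in the hierarchy differ only on singular lines. -/
theorem exists_sing_of_ne {x y : Config Tile 2} (hx : x ∈ rob.carrier)
    (hs : ∀ n u, Approx n x u → Approx n y u) {q : Lattice 2} (hq : x q ≠ y q) :
    ∃ i, Sing i x (q i) := by
  by_contra hcon
  unfold Sing at hcon
  push Not at hcon
  choose n u hu hd using hcon
  obtain ⟨w, hw⟩ := exists_approx hx (max (n 0) (n 1))
  have hn : ∀ i, n i ≤ max (n 0) (n 1) := fun i => by fin_cases i <;> simp
  have nd : ∀ i, ¬ (2 : ℤ) ^ (max (n 0) (n 1) + 2) ∣ (w + q) i := fun i hdv => hd i <| by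
    have h1 := (pow_dvd_pow 2 (show n i + 2 ≤ _ by have := hn i; omega)).trans hdv
    have h2 := (pow_dvd_pow 2 (show n i + 2 ≤ n i + 3 by omega)).trans
      ((hu i).unique (hw.mono (hn i)) i)
    have e : u i i + q i = (w + q) i - (w i - u i i) := by simp; ring
    rw [e]
    exact dvd_sub h1 h2
  exact hq ((hw q nd).trans (hs _ _ hw q nd).symm)

namespace Dir

/-- The coordinate that changes along a direction. -/
def ax (d : Dir) : Fin 2 := if d.vert then 1 else 0

/-- The coordinate that is constant along a direction. -/
def co (d : Dir) : Fin 2 := if d.vert then 0 else 1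

end Dir

/-- Along the ray the neighbours on either side are off the singular lines, hence equal in both
points. If the next tiles agreed too, three neighbours would force the present tiles to agree. -/
theorem exists_ray_of_not_sing {x y : Config Tile 2} (hx : x ∈ rob.carrier) (hy : y ∈ rob.carrier)
    (hs : ∀ n u, Approx n x u → Approx n y u) {q : Lattice 2} (hq : x q ≠ y q) (d₀ : Dir)
    (hq' : ¬ Sing d₀.ax x (q d₀.ax)) :
    ∃ d : Dir, Sing d.co x (q d.co) ∧
      ∀ t : ℕ, x (q + (t : ℤ) • d.vec) ≠ y (q + (t : ℤ) • d.vec) := by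
  have hax : ∀ p, Dir.ax ⟨d₀.vert, p⟩ = d₀.ax := fun p => rfl
  -- At most one singular line crosses the path, and the ray runs away from it.
  obtain ⟨p, hp⟩ : ∃ p : Bool, ∀ t : ℕ, ¬ Sing d₀.ax x
      (q d₀.ax + t * (if p then 1 else -1)) := by
    by_cases hc : ∃ c, q d₀.ax < c ∧ Sing d₀.ax x c
    · obtain ⟨c, hc1, hc2⟩ := hc
      refine ⟨false, fun t ht => ?_⟩
      have := Sing.unique hx ht hc2
      simp at this
      omega
    · push Not at hc
      refine ⟨true, fun t ht => ?_⟩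
      simp only [if_true, mul_one] at ht
      rcases Nat.eq_zero_or_pos t with rfl | h0
      · simp at ht
        exact hq' ht
      · exact hc _ (by omega) ht
  generalize hd : (⟨d₀.vert, p⟩ : Dir) = d
  have hdax : d.ax = d₀.ax := by rw [← hd, hax]
  have hdv : d.vec d₀.ax = if p then 1 else -1 := by
    rw [← hdax, ← hd]
    simp [Dir.vec, Dir.ax]
  have hdco : d.vec d.co = 0 := by
    rcases d with ⟨_ | _, _ | _⟩ <;> rfl
  have hfin : ∀ i : Fin 2, i = d.ax ∨ i = d.co := by
    rcases d with ⟨_ | _, _ | _⟩ <;> decide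
  have hS : Sing d.co x (q d.co) := by
    obtain ⟨i, hi⟩ := exists_sing_of_ne hx hs hq
    rcases hfin i with rfl | rfl
    · rw [hdax] at hi
      exact absurd hi hq'
    · exact hi
  refine ⟨d, hS, fun t => ?_⟩
  induction t with
  | zero => simpa using hq
  | succ t ih =>
    intro heq
    apply ih
    have rx := (rob_subset_robinsonShift hx).1
    have ry := (rob_subset_robinsonShift hy).1
    refine Tile.eq_of_matches d.opp (nb := fun d' => x (q + (t : ℤ) • d.vec + d'.vec))
      (fun d' _ => rx _ _) fun d' hd' => ?_
    have : x (q + (t : ℤ) • d.vec + d'.vec) = y (q + (t : ℤ) • d.vec + d'.vec) := by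
      by_cases hdd : d' = d
      · subst hdd
        rw [add_assoc, ← add_one_zsmul]
        exact_mod_cast heq
      · by_contra hne
        have h1 : d'.vec d.ax = 0 := by
          revert hdd hd'
          rcases d with ⟨_ | _, _ | _⟩ <;> rcases d' with ⟨_ | _, _ | _⟩ <;> decide
        have h2 : d'.vec d.co ≠ 0 := by
          revert hdd hd'
          rcases d with ⟨_ | _, _ | _⟩ <;> rcases d' with ⟨_ | _, _ | _⟩ <;> decide
        obtain ⟨i, hi⟩ := exists_sing_of_ne hx hs hne
        rcases hfin i with rfl | rfl
        · simp only [Pi.add_apply, Pi.smul_apply, h1, add_zero, smul_eq_mul] at hi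
          rw [hdax, hdv] at hi
          exact hp t hi
        · have := Sing.unique hx hi hS
          simp [hdco] at this
          exact h2 this
    simp only [this]
    exact ry _ _

theorem exists_ray {x y : Config Tile 2} (hx : x ∈ rob.carrier) (hy : y ∈ rob.carrier)
    (hs : ∀ n u, Approx n x u → Approx n y u) (hne : x ≠ y) :
    ∃ (d : Dir) (q : Lattice 2), Sing d.co x (q d.co) ∧
      ∀ t : ℕ, x (q + (t : ℤ) • d.vec) ≠ y (q + (t : ℤ) • d.vec) := by
  obtain ⟨q, hq⟩ := Function.ne_iff.1 hne
  by_cases hall : ∀ i, Sing i x (q i)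
  -- At the crossing of two singular lines the difference passes to some neighbour, which lies on
  -- only one of them.
  · obtain ⟨d, hd⟩ : ∃ d : Dir, x (q + d.vec) ≠ y (q + d.vec) := by
      by_contra! hcon
      refine hq (Tile.eq_of_matches ⟨true, true⟩ (nb := fun d => x (q + d.vec))
        (fun d _ => (rob_subset_robinsonShift hx).1 _ _) fun d _ => ?_)
      simp only [hcon d]
      exact (rob_subset_robinsonShift hy).1 _ _
    have hns : ¬ Sing d.ax x ((q + d.vec) d.ax) := fun h => by
      have := Sing.unique hx h (hall d.ax)
      have h2 : d.vec d.ax ≠ 0 := by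
        rcases d with ⟨_ | _, _ | _⟩ <;> decide
      simp at this
      exact h2 this
    obtain ⟨d', h1, h2⟩ := exists_ray_of_not_sing hx hy hs hd d hns
    exact ⟨d', _, h1, h2⟩
  · push Not at hall
    obtain ⟨i, hi⟩ := hall
    obtain ⟨d, hd⟩ : ∃ d : Dir, d.ax = i := by
      fin_cases i
      · exact ⟨⟨false, true⟩, rfl⟩
      · exact ⟨⟨true, true⟩, rfl⟩
    subst hd
    obtain ⟨d', h1, h2⟩ := exists_ray_of_not_sing hx hy hs hq d hi
    exact ⟨d', _, h1, h2⟩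

/-! ### The extended symmetries -/

/-- The configuration shows the hierarchical tiling off the two axes. -/
def OffAxis (y : Config Tile 2) : Prop := ∀ p : Lattice 2, (∀ i, p i ≠ 0) → y p = hier p

theorem OffAxis.approx {y : Config Tile 2} (hy : OffAxis y) (n : ℕ) : Approx n y 0 := by
  intro p hp
  rw [zero_add] at hp ⊢
  exact hy p fun i => ne_zero_of_not_dvd (hp i)

theorem offAxis_rowPoint (e : Bool) : OffAxis (rowPoint e) := by
  intro p hp
  simp [rowPoint, hp 0, hp 1]

theorem OffAxis.swap {y : Config Tile 2} (hy : OffAxis y) : OffAxis (swapConfig y) := by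
  intro p hp
  have h0 := hp 0
  have h1 := hp 1
  rw [swapConfig, hy _ fun i => by fin_cases i <;> simpa, ← hier_swap]
  congr
  ext i
  fin_cases i <;> simp

theorem OffAxis.refl {y : Config Tile 2} (hy : OffAxis y) : OffAxis (reflConfig y) := by
  intro p hp
  have h0 := hp 0
  have h1 := hp 1
  rw [reflConfig, hy _ fun i => by fin_cases i <;> simpa, ← hier_refl (by simpa)]
  congr
  ext i
  fin_cases i <;> simp

theorem Approx.shift {n : ℕ} {x : Config Tile 2} {u : Lattice 2} (h : Approx n x u)
    (v : Lattice 2) : Approx n (shift v x) (u - v) := by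
  intro p hp
  have e : u - v + p = u + (p - v) := by abel
  rw [e] at hp ⊢
  exact h _ hp

theorem shift_shift {x : Config Tile 2} (v w : Lattice 2) : shift v (shift w x) = shift (v + w) x := by
  funext p
  simp only [shift]
  congr 1
  abel

theorem shift_zero (x : Config Tile 2) : shift 0 x = x := by
  funext p
  simp [shift]

/-- Points of `rob` have no periods. -/
theorem shift_injective {x : Config Tile 2} (hx : x ∈ rob.carrier) {v w : Lattice 2}
    (h : shift v x = shift w x) : v = w := by
  ext i
  refine eq_of_forall_pow_dvd fun n => ?_
  obtain ⟨u, hu⟩ := exists_approx hx n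
  have h1 := hu.shift v
  rw [h] at h1
  have := h1.unique (hu.shift w) i
  simp only [Pi.sub_apply, sub_sub_sub_cancel_left] at this
  exact (pow_dvd_pow 2 (by omega)).trans this

theorem offAxis_shift_injective {z : Config Tile 2} {v w : Lattice 2}
    (hv : OffAxis (shift v z)) (hw : OffAxis (shift w z)) : v = w := by
  ext i
  refine eq_of_forall_pow_dvd fun n => ?_
  have h1 := (hv.approx n).shift (-v)
  have h2 := (hw.approx n).shift (-w)
  rw [shift_shift, neg_add_cancel, shift_zero] at h1 h2
  have := h2.unique h1 i
  simp only [Pi.sub_apply, Pi.zero_apply, Pi.neg_apply, sub_neg_eq_add, zero_add] at this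
  exact (pow_dvd_pow 2 (by omega)).trans this

theorem offAxis_of_sing {z : Config Tile 2} (hz : z ∈ rob.carrier) {w : Lattice 2}
    (h : ∀ i, Sing i z (w i)) : OffAxis (shift (-w) z) := by
  intro p hp
  obtain ⟨n, hn⟩ := exists_mem_box p
  have nd : ∀ i, ¬ (2 : ℤ) ^ (n + 1) ∣ p i := fun i hd => by
    have h1 := Int.le_of_dvd (abs_pos.2 (hp i)) ((dvd_abs _ _).2 hd)
    have h2 := hn i
    have h3 : (n : ℤ) < 2 ^ n := by exact_mod_cast Nat.lt_two_pow_self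
    rw [pow_succ] at h1
    omega
  obtain ⟨u, hu⟩ := exists_approx hz n
  have e : ∀ i, (u + (p - -w)) i = p i + (u i + w i) := fun i => by simp; ring
  change z (p - -w) = _
  rw [hu (p - -w) fun i hd => ?_]
  · refine hier_congr nd fun i => ?_
    rw [e, add_sub_cancel_left]
    exact h i n u hu
  · rw [e] at hd
    exact nd i ((pow_dvd_pow 2 (by omega)).trans ((dvd_add_left (h i n u hu)).1 hd))

theorem apply_eq_of_isMorphism {M : GL (Fin 2) ℤ} {f : rob.carrier → rob.carrier}
    (hf : rob.IsMorphism M f) (x : rob.carrier) (q : Lattice 2) :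
    (f x).1 q = (f (rob.shiftMap (-((M⁻¹).1 *ᵥ q)) x)).1 0 := by
  rw [hf, mulVec_neg, mulVec_mulVec, ← Units.val_mul, mul_inv_cancel, Units.val_one, one_mulVec]
  simp [Subshift.shiftMap, shift]

/-- Differences in the image of a symmetry come from nearby differences. -/
theorem exists_ne_of_apply_ne {M : GL (Fin 2) ℤ} {f : rob.carrier → rob.carrier}
    (hf : rob.IsMorphism M f) {R : ℕ}
    (hR : ∀ x y : rob.carrier, (∀ p ∈ box R, x.1 p = y.1 p) → (f x).1 0 = (f y).1 0)
    {x y : rob.carrier} {q : Lattice 2} (hq : (f x).1 q ≠ (f y).1 q) :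
    ∃ w ∈ box R, x.1 ((M⁻¹).1 *ᵥ q + w) ≠ y.1 ((M⁻¹).1 *ᵥ q + w) := by
  by_contra! hcon
  refine hq ?_
  rw [apply_eq_of_isMorphism hf x, apply_eq_of_isMorphism hf y]
  refine hR _ _ fun p hp => ?_
  change x.1 (p - -((M⁻¹).1 *ᵥ q)) = y.1 (p - -((M⁻¹).1 *ᵥ q))
  rw [sub_neg_eq_add, add_comm]
  exact hcon p hp

theorem exists_box_mulVec (B : Matrix (Fin 2) (Fin 2) ℤ) (K : ℕ) :
    ∃ C, ∀ p ∈ box K, B *ᵥ p ∈ box C := by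
  choose N hN using exists_mem_box
  refine ⟨((finite_box K).toFinset).sup fun p => N (B *ᵥ p), fun p hp => ?_⟩
  exact box_mono (Finset.le_sup (f := fun p => N (B *ᵥ p)) ((finite_box K).mem_toFinset.2 hp))
    (hN _)

/-- Two such points agree off the axes, so their images agree on a box whose preimage stays far from
the axes; this box fixes the position at level `n`. -/
theorem approx_apply_of_offAxis {M : GL (Fin 2) ℤ} {f : rob.carrier → rob.carrier}
    (hc : Continuous f) (hf : rob.IsMorphism M f) {x y : rob.carrier} (hx : OffAxis x.1)
    (hy : OffAxis y.1) (n : ℕ) (u : Lattice 2) (hu : Approx n (f x).1 u) : Approx n (f y).1 u := by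
  obtain ⟨R, hR⟩ := exists_radius rob hc
  obtain ⟨C, hC⟩ := exists_box_mulVec (M⁻¹).1 (2 ^ (n + 2))
  obtain ⟨u', hu'⟩ := exists_approx (f y).2 n
  obtain ⟨s, hs⟩ : ∃ s : Lattice 2, ∀ i, s i = (C : ℤ) + R + 1 := ⟨fun _ => _, fun _ => rfl⟩
  refine hu'.congr (hu'.unique_of_agree hu (c := M.1 *ᵥ s) fun p hp => ?_)
  by_contra hne
  obtain ⟨w, hw, h⟩ := exists_ne_of_apply_ne hf hR hne
  have e : (M⁻¹).1 *ᵥ p = s + (M⁻¹).1 *ᵥ (p - M.1 *ᵥ s) := by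
    rw [mulVec_sub, mulVec_mulVec, ← Units.val_mul, inv_mul_cancel, Units.val_one, one_mulVec]
    abel
  have hb := hC (p - M.1 *ᵥ s) fun i => by
    have := hp i
    rw [Pi.sub_apply, abs_of_nonneg this.1]
    push_cast
    exact this.2.le
  have off : ∀ i, ((M⁻¹).1 *ᵥ p + w) i ≠ 0 := fun i => by
    have h1 := abs_le.1 (hb i)
    have h2 := abs_le.1 (hw i)
    rw [e]
    simp only [Pi.add_apply, hs]
    omega
  exact h ((hy _ off).trans (hx _ off).symm)

theorem eq_zero_of_bounded {a b : ℤ} {R : ℕ} (h : ∀ t : ℕ, |a + t * b| ≤ R) : b = 0 := by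
  by_contra hb
  have h0 := h 0
  have h1 := h (2 * R + 1)
  have h2 : (1 : ℤ) ≤ |b| := Int.one_le_abs hb
  have h3 : |((2 * R + 1 : ℕ) : ℤ) * b| ≤ 2 * R := by
    have := abs_sub (a + ((2 * R + 1 : ℕ) : ℤ) * b) (a + ((0 : ℕ) : ℤ) * b)
    rw [show a + ((2 * R + 1 : ℕ) : ℤ) * b - (a + ((0 : ℕ) : ℤ) * b) =
      ((2 * R + 1 : ℕ) : ℤ) * b by push_cast; ring] at this
    linarith
  rw [abs_mul, abs_of_nonneg (by positivity)] at h3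
  push_cast at h3
  nlinarith

/-- A symmetry maps a singular row or column to a singular row or column. -/
theorem exists_dir_of_line {M : GL (Fin 2) ℤ} {f : rob.carrier ≃ₜ rob.carrier}
    (hf : rob.IsMorphism M f) (j : Fin 2) {x y : rob.carrier} (hx : OffAxis x.1) (hy : OffAxis y.1)
    (hne : x ≠ y) (hj : ∀ p : Lattice 2, p j ≠ 0 → x.1 p = y.1 p) :
    ∃ (d : Dir) (c : ℤ), Sing d.co (f x).1 c ∧ ((M⁻¹).1 *ᵥ d.vec) j = 0 := by
  obtain ⟨R, hR⟩ := exists_radius rob f.continuous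
  obtain ⟨d, q, h1, h2⟩ := exists_ray (f x).2 (f y).2
    (approx_apply_of_offAxis f.continuous hf hx hy)
    (fun h => hne (f.injective (Subtype.ext h)))
  -- Each difference on the ray pulls back to within `R` of the line, so the affine function of `t`
  -- is bounded and has slope zero.
  refine ⟨d, _, h1, eq_zero_of_bounded (a := ((M⁻¹).1 *ᵥ q) j) (R := R) fun t => ?_⟩
  obtain ⟨w, hw, h⟩ := exists_ne_of_apply_ne hf hR (h2 t)
  have h3 : ((M⁻¹).1 *ᵥ (q + (t : ℤ) • d.vec) + w) j = 0 := by
    by_contra hcon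
    exact h (hj _ hcon)
  rw [mulVec_add, mulVec_smul] at h3
  simp only [Pi.add_apply, Pi.smul_apply, smul_eq_mul] at h3
  rw [show ((M⁻¹).1 *ᵥ q) j + t * ((M⁻¹).1 *ᵥ d.vec) j = -w j by linarith, abs_neg]
  exact hw j

theorem exists_dihedral_of_dirs : ∀ d d' : Dir, d.vert ≠ d'.vert →
    ∃ g : DihedralGroup 4, dihedralMatrix g = !![d.vec 0, d'.vec 0; d.vec 1, d'.vec 1] := by
  decide

/-- An invertible matrix that maps some unit vector into the line of `e_i` maps `e_i` to a
unit vector. -/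
theorem exists_dir_of_mulVec {M : GL (Fin 2) ℤ} {i j : Fin 2} (hij : i ≠ j) {d : Dir}
    (h : ((M⁻¹).1 *ᵥ d.vec) j = 0) :
    ∃ d' : Dir, d'.vert = d.vert ∧ M.1 *ᵥ Pi.single i 1 = d'.vec := by
  have e : (M⁻¹).1 *ᵥ d.vec = ((M⁻¹).1 *ᵥ d.vec) i • (Pi.single i 1 : Lattice 2) := by
    ext l
    by_cases hl : l = i
    · subst hl; simp
    · have : l = j := by omega
      subst this
      rw [h, Pi.smul_apply, Pi.single_eq_of_ne hl, smul_zero]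
  generalize ((M⁻¹).1 *ᵥ d.vec) i = c at e
  have e2 : d.vec = c • (M.1 *ᵥ Pi.single i 1) := by
    rw [← mulVec_smul, ← e, mulVec_mulVec, ← Units.val_mul, mul_inv_cancel, Units.val_one,
      one_mulVec]
  have hc : c = 1 ∨ c = -1 := by
    have h1 := congrFun e2 d.ax
    have h2 : d.vec d.ax = 1 ∨ d.vec d.ax = -1 := by
      rcases d with ⟨_ | _, _ | _⟩ <;> decide
    simp only [Pi.smul_apply, smul_eq_mul] at h1
    rw [← Int.isUnit_iff]
    rw [← Int.isUnit_iff, h1] at h2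
    exact isUnit_of_mul_isUnit_left h2
  rcases hc with rfl | rfl
  · exact ⟨d, rfl, by rw [e2, one_smul]⟩
  · refine ⟨d.opp, rfl, ?_⟩
    have : d.opp.vec = -d.vec := by
      rcases d with ⟨_ | _, _ | _⟩ <;> decide
    rw [this, e2, neg_smul, one_smul, neg_neg]

/-- The symmetry `f` has the linear part `g` and moves the singular point of the hierarchy at
the origin to `w`. -/
def Normal (f : rob.carrier ≃ₜ rob.carrier) (g : DihedralGroup 4) (w : Lattice 2) : Prop :=
  rob.IsMorphism (dihedralMatrix.toHomUnits g) f ∧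
    ∀ y : rob.carrier, OffAxis y.1 → OffAxis (shift (-w) (f y).1)

theorem exists_normal {f : rob.carrier ≃ₜ rob.carrier} (hf : f ∈ rob.Sym) :
    ∃ g w, Normal f g w := by
  obtain ⟨M, hM⟩ := hf
  let x : Bool → rob.carrier := fun e => ⟨rowPoint e, rowPoint_mem e⟩
  let y : Bool → rob.carrier := fun e => ⟨swapConfig (rowPoint e), swapConfig_mem (rowPoint_mem e)⟩
  have hx : ∀ e, OffAxis (x e).1 := offAxis_rowPoint
  have hy : ∀ e, OffAxis (y e).1 := fun e => (offAxis_rowPoint e).swap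
  have hxne : x true ≠ x false := fun h => by
    have := congrFun (congrArg Subtype.val h) 0
    simp [x, rowPoint] at this
  have hyne : y true ≠ y false := fun h => by
    have := congrFun (congrArg Subtype.val h) 0
    simp [y, rowPoint, swapConfig, Tile.swap, Dir.swap] at this
  obtain ⟨d, c, h1, h2⟩ := exists_dir_of_line hM 1 (hx true) (hx false) hxne fun p hp => by
    simp [x, rowPoint, hp]
  obtain ⟨d', c', h1', h2'⟩ := exists_dir_of_line hM 0 (hy true) (hy false) hyne fun p hp => by
    simp [y, rowPoint, swapConfig, hp]
  -- Both images have the same position, so the singular line found for the second pair is also one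
  -- of `f (x true)`.
  have h1'' : Sing d'.co (f (x true)).1 c' := fun n u hu =>
    h1' n u (approx_apply_of_offAxis f.continuous hM (hx true) (hy true) n u hu)
  obtain ⟨a, ha1, ha2⟩ := exists_dir_of_mulVec (i := 0) (by decide) h2
  obtain ⟨b, hb1, hb2⟩ := exists_dir_of_mulVec (i := 1) (by decide) h2'
  have hMat : M.1 = !![a.vec 0, b.vec 0; a.vec 1, b.vec 1] := by
    rw [mulVec_single_one] at ha2 hb2
    ext i j
    have a0 := congrFun ha2 i
    have b0 := congrFun hb2 i
    fin_cases i <;> fin_cases j <;> simpa using by assumption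
  have hvert : a.vert ≠ b.vert := by
    intro hab
    have hdet : M.1.det ≠ 0 := fun h0 => by
      have := (isUnit_iff_isUnit_det _).1 M.isUnit
      rw [h0] at this
      simp at this
    apply hdet
    rw [hMat, det_fin_two_of]
    revert hab
    clear * -
    revert a b
    decide
  obtain ⟨g, hg⟩ := exists_dihedral_of_dirs a b hvert
  have hMg : M = dihedralMatrix.toHomUnits g := Units.ext (hMat.trans hg.symm)
  -- One of the two lines is a row and the other a column; which is which depends on whether `M`
  -- exchanges the axes.
  obtain ⟨w, hw⟩ : ∃ w : Lattice 2, ∀ i, Sing i (f (x true)).1 (w i) := by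
    rw [ha1, hb1] at hvert
    cases hv : d.vert
    · rw [hv] at hvert
      have hv' : d'.vert = true := by simpa using hvert.symm
      simp only [Dir.co, hv, hv', if_true, Bool.false_eq_true, if_false] at h1 h1''
      refine ⟨![c', c], fun i => ?_⟩
      fin_cases i
      · exact h1''
      · exact h1
    · rw [hv] at hvert
      have hv' : d'.vert = false := by simpa using hvert.symm
      simp only [Dir.co, hv, hv', if_true, Bool.false_eq_true, if_false] at h1 h1''
      refine ⟨![c, c'], fun i => ?_⟩
      fin_cases i
      · exact h1
      · exact h1''
  refine ⟨g, w, hMg ▸ hM, fun z hz => offAxis_of_sing (f z).2 fun i n u hu => ?_⟩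
  exact hw i n u (approx_apply_of_offAxis f.continuous hM hz (hx true) n u hu)

/-- Aperiodicity determines `g`, and recognizability determines `w`. -/
theorem Normal.unique {f : rob.carrier ≃ₜ rob.carrier} {g g' : DihedralGroup 4} {w w' : Lattice 2}
    (h : Normal f g w) (h' : Normal f g' w') : g = g' ∧ w = w' := by
  let x : rob.carrier := ⟨rowPoint true, rowPoint_mem true⟩
  constructor
  · have inj : Function.Injective dihedralMatrix := by
      unfold Function.Injective
      decide
    apply inj
    apply Matrix.mulVec_injective
    funext v
    refine shift_injective (f x).2 ?_
    exact congrArg Subtype.val ((h.1 v x).symm.trans (h'.1 v x))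
  · exact neg_injective (offAxis_shift_injective (h.2 x (offAxis_rowPoint true))
      (h'.2 x (offAxis_rowPoint true)))

theorem Normal.mul {f f' : rob.carrier ≃ₜ rob.carrier} {g g' : DihedralGroup 4}
    {w w' : Lattice 2} (h : Normal f g w) (h' : Normal f' g' w') :
    Normal (f * f') (g * g') (w + dihedralMatrix g *ᵥ w') := by
  constructor
  · intro v x
    have h1 : f (f' (rob.shiftMap v x)) =
        rob.shiftMap ((dihedralMatrix.toHomUnits (g * g')).1 *ᵥ v) (f (f' x)) := by
      rw [h'.1 v x, h.1, mulVec_mulVec, map_mul]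
      rfl
    exact h1
  · intro y hy
    let z : rob.carrier := rob.shiftMap (-w') (f' y)
    have hz : OffAxis z.1 := h'.2 y hy
    have e : f' y = rob.shiftMap w' z := by
      apply Subtype.ext
      simp [z, Subshift.shiftMap, shift_shift, shift_zero]
    have e2 : ((f * f') y).1 = shift (dihedralMatrix g *ᵥ w') (f z).1 := by
      change (f (f' y)).1 = _
      rw [e, h.1]
      rfl
    rw [e2, shift_shift, neg_add_rev, add_assoc, neg_add_eq_sub, add_comm]
    have h3 := h.2 z hz
    convert h3 using 2
    abel

/-- A symmetry that commutes with the shifts and fixes the singular point is trivial. -/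
theorem Normal.eq_one {f : rob.carrier ≃ₜ rob.carrier} (h : Normal f 1 0) : f = 1 := by
  have hm : ∀ v x, f (rob.shiftMap v x) = rob.shiftMap v (f x) := fun v x => by
    have := h.1 v x
    simpa using this
  obtain ⟨R, hR⟩ := exists_radius rob f.continuous
  let x : rob.carrier := ⟨rowPoint true, rowPoint_mem true⟩
  have hx : OffAxis x.1 := offAxis_rowPoint true
  have hfx : OffAxis (f x).1 := by
    have := h.2 x hx
    rwa [neg_zero, shift_zero] at this
  have zero : ∀ y : rob.carrier, (f y).1 0 = y.1 0 := fun y => by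
    obtain ⟨u, hu⟩ := y.2 R
    have h0 := hu 0 fun i => by simp
    -- Near the origin `y` looks like `x` near `u`, away from the axes. The local rule therefore
    -- gives `(f x) u = hier u`, which is also the tile of `y` at the origin.
    rw [hR y (rob.shiftMap (-u) x) fun p hp => ?_, hm]
    · change (f x).1 (0 - -u) = _
      rw [sub_neg_eq_add, zero_add, h0.2, add_zero]
      exact hfx u (by simpa using h0.1)
    · change _ = x.1 (p - -u)
      have h1 := hu p hp
      rw [h1.2, sub_neg_eq_add, add_comm p, hx _ h1.1]
  ext y q
  have h1 := zero (rob.shiftMap (-q) y)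
  rw [hm] at h1
  change (f y).1 (0 - -q) = y.1 (0 - -q) at h1
  rwa [sub_neg_eq_add, zero_add] at h1

/-! ### Realisation of all pairs of linear part and translation. -/

theorem normal_one : Normal 1 1 0 :=
  ⟨fun v x => by simp, fun y hy => by rw [neg_zero, shift_zero]; exact hy⟩

theorem continuous_shiftMap (w : Lattice 2) : Continuous (rob.shiftMap w) :=
  Continuous.subtype_mk (f := fun x : rob.carrier => shift w x.1)
    (continuous_pi fun p => (continuous_apply (p - w)).comp continuous_subtype_val) _

/-- The shift by `w` as a homeomorphism. -/
def shiftHomeo (w : Lattice 2) : rob.carrier ≃ₜ rob.carrier where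
  toFun := rob.shiftMap w
  invFun := rob.shiftMap (-w)
  left_inv x := Subtype.ext (by simp [Subshift.shiftMap, shift_shift, shift_zero])
  right_inv x := Subtype.ext (by simp [Subshift.shiftMap, shift_shift, shift_zero])
  continuous_toFun := continuous_shiftMap w
  continuous_invFun := continuous_shiftMap (-w)

theorem normal_shiftHomeo (w : Lattice 2) : Normal (shiftHomeo w) 1 w := by
  refine ⟨fun v x => Subtype.ext ?_, fun y hy => ?_⟩
  · simp [shiftHomeo, Subshift.shiftMap, shift_shift, add_comm]
  · change OffAxis (shift (-w) (shift w y.1))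
    rwa [shift_shift, neg_add_cancel, shift_zero]

def reflHomeo : rob.carrier ≃ₜ rob.carrier where
  toFun x := ⟨reflConfig x.1, reflConfig_mem x.2⟩
  invFun x := ⟨reflConfig x.1, reflConfig_mem x.2⟩
  left_inv x := Subtype.ext (reflConfig_reflConfig x.1)
  right_inv x := Subtype.ext (reflConfig_reflConfig x.1)
  continuous_toFun := Continuous.subtype_mk (continuous_pi fun _ =>
    continuous_of_discreteTopology.comp ((continuous_apply _).comp continuous_subtype_val)) _
  continuous_invFun := Continuous.subtype_mk (continuous_pi fun _ =>
    continuous_of_discreteTopology.comp ((continuous_apply _).comp continuous_subtype_val)) _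

def swapHomeo : rob.carrier ≃ₜ rob.carrier where
  toFun x := ⟨swapConfig x.1, swapConfig_mem x.2⟩
  invFun x := ⟨swapConfig x.1, swapConfig_mem x.2⟩
  left_inv x := Subtype.ext (swapConfig_swapConfig x.1)
  right_inv x := Subtype.ext (swapConfig_swapConfig x.1)
  continuous_toFun := Continuous.subtype_mk (continuous_pi fun _ =>
    continuous_of_discreteTopology.comp ((continuous_apply _).comp continuous_subtype_val)) _
  continuous_invFun := Continuous.subtype_mk (continuous_pi fun _ =>
    continuous_of_discreteTopology.comp ((continuous_apply _).comp continuous_subtype_val)) _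

theorem normal_reflHomeo : Normal reflHomeo (.sr 0) 0 := by
  refine ⟨fun v x => Subtype.ext (funext fun p => ?_), fun y hy => ?_⟩
  · have hmat : (dihedralMatrix.toHomUnits (.sr 0)).1 = !![-1, 0; 0, 1] := by
      change dihedralMatrix (.sr 0) = _
      decide
    rw [hmat]
    change (x.1 (![-p 0, p 1] - v)).refl =
      (x.1 ![-(p - !![-1, 0; 0, 1] *ᵥ v) 0, (p - !![-1, 0; 0, 1] *ᵥ v) 1]).refl
    refine congrArg (fun q => (x.1 q).refl) ?_
    ext i
    fin_cases i <;> simp [dotProduct, Fin.sum_univ_two]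
    ring
  · rw [neg_zero, shift_zero]
    exact hy.refl

theorem normal_swapHomeo : Normal swapHomeo (.sr 1) 0 := by
  refine ⟨fun v x => Subtype.ext (funext fun p => ?_), fun y hy => ?_⟩
  · have hmat : (dihedralMatrix.toHomUnits (.sr 1)).1 = !![0, 1; 1, 0] := by
      change dihedralMatrix (.sr 1) = _
      decide
    rw [hmat]
    change (x.1 (![p 1, p 0] - v)).swap =
      (x.1 ![(p - !![0, 1; 1, 0] *ᵥ v) 1, (p - !![0, 1; 1, 0] *ᵥ v) 0]).swap
    refine congrArg (fun q => (x.1 q).swap) ?_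
    ext i
    fin_cases i <;> simp [dotProduct, Fin.sum_univ_two]
  · rw [neg_zero, shift_zero]
    exact hy.swap

theorem exists_normal_zero (g : DihedralGroup 4) : ∃ f, Normal f g 0 := by
  have mul : ∀ {g g'}, (∃ f, Normal f g 0) → (∃ f, Normal f g' 0) → ∃ f, Normal f (g * g') 0 := by
    rintro g g' ⟨f, hf⟩ ⟨f', hf'⟩
    exact ⟨f * f', by simpa using hf.mul hf'⟩
  have r1 : ∃ f, Normal f (.r 1) 0 := by
    have := mul ⟨_, normal_reflHomeo⟩ ⟨_, normal_swapHomeo⟩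
    rwa [DihedralGroup.sr_mul_sr, sub_zero] at this
  have pow : ∀ n : ℕ, ∃ f, Normal f (.r 1 ^ n) 0 := fun n => by
    induction n with
    | zero => exact ⟨1, normal_one⟩
    | succ n ih => rw [pow_succ]; exact mul ih r1
  have rot : ∀ i : ZMod 4, ∃ f, Normal f (.r i) 0 := fun i => by
    have := pow i.val
    rwa [DihedralGroup.r_one_pow, ZMod.natCast_zmod_val] at this
  cases g with
  | r i => exact rot i
  | sr i =>
    have := mul ⟨_, normal_reflHomeo⟩ (rot i)
    rwa [DihedralGroup.sr_mul_r, zero_add] at this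

theorem exists_normal_all (g : DihedralGroup 4) (w : Lattice 2) : ∃ f, Normal f g w := by
  obtain ⟨f, hf⟩ := exists_normal_zero g
  exact ⟨shiftHomeo w * f, by simpa using (normal_shiftHomeo w).mul hf⟩

/-- The normal form `(w, g)` of a symmetry is unique, so `Normal.mul` says that taking it is a
homomorphism; it is injective by `Normal.eq_one` and surjective by `exists_normal_all`. -/
theorem nonempty_sym_mulEquiv : Nonempty (rob.Sym ≃*
    Multiplicative (Lattice 2) ⋊[dihedralAction] DihedralGroup 4) := by
  choose g w h using fun f : rob.Sym => exists_normal f.2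
  let φ : rob.Sym →* Multiplicative (Lattice 2) ⋊[dihedralAction] DihedralGroup 4 :=
    MonoidHom.mk' (fun f => ⟨Multiplicative.ofAdd (w f), g f⟩) fun f f' => by
      obtain ⟨h1, h2⟩ := (h (f * f')).unique ((h f).mul (h f'))
      rw [h1, h2]
      rfl
  refine ⟨MulEquiv.ofBijective φ ⟨?_, ?_⟩⟩
  · rw [injective_iff_map_eq_one]
    intro f hf
    have h1 : w f = 0 := congrArg (fun s => s.left.toAdd) hf
    have h2 : g f = 1 := congrArg (fun s => s.right) hf
    have := h f
    rw [h1, h2] at this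
    exact Subtype.ext this.eq_one
  · rintro ⟨v, k⟩
    obtain ⟨f, hf⟩ := exists_normal_all k v.toAdd
    refine ⟨⟨f, _, hf.1⟩, ?_⟩
    obtain ⟨h1, h2⟩ := (h ⟨f, _, hf.1⟩).unique hf
    change (⟨_, _⟩ : Multiplicative (Lattice 2) ⋊[dihedralAction] DihedralGroup 4) = _
    rw [h1, h2]
    rfl

end Robinson

theorem mainTheorem7 :
    (∃! M : Robinson.Subshift Robinson.Tile 2,
      M.IsMinimal ∧ M.carrier ⊆ Robinson.robinsonShift) ∧
    ∀ M : Robinson.Subshift Robinson.Tile 2,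
      M.IsMinimal → M.carrier ⊆ Robinson.robinsonShift →
        Nonempty (M.Sym ≃*
          Multiplicative (Robinson.Lattice 2) ⋊[Robinson.dihedralAction] DihedralGroup 4) := by
  refine ⟨⟨Robinson.rob, ⟨Robinson.rob_isMinimal, Robinson.rob_subset_robinsonShift⟩,
    fun M hM => Robinson.eq_rob_of_isMinimal hM.1 hM.2⟩, fun M hM hsub => ?_⟩
  rw [Robinson.eq_rob_of_isMinimal hM hsub]
  exact Robinson.nonempty_sym_mulEquiv
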